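/- Let $\mathfrak{D}_n$ be the set of signed permutations $\pi=\pi_1,\dots,\pi_n$ of $[n]$ (words whose absolute values form a permutation of $[n]$) with an even number of negative entries, and put $\pi_{-1}=-\pi_1$. For $\pi\in\mathfrak{D}_n$ let $\mathrm{des}_D(\pi)$ be the number of $i\in\{-1,1,2,\dots,n-1\}$ with $\pi_i>\pi_{|i|+1}$, let $\mathrm{odes}_D(\pi)$ be the number of odd such $i$, let $\mathrm{easc}_D(\pi)$ be the number of even $i\in[n-1]$ with $\pi_i<\pi_{i+1}$, and let $$\mathrm{inv}_D(\pi)=|\{1\le i<j\le n:\pi_i>\pi_j\}|+|\{1\le i<j\le n:-\pi_i>\pi_j\}|.$$ Define $$D_n(t,q)=\sum_{\pi\in\mathfrak{D}_n}t^{\mathrm{des}_D(\pi)}q^{\mathrm{inv}_D(\pi)},\qquad \hat D_n(s,t,q)=\sum_{\pi\in\mathfrak{D}_n}t^{\mathrm{odes}_D(\pi)}s^{\mathrm{easc}_D(\pi)}q^{\mathrm{inv}_D(\pi)},$$ $$\widehat{\mathcal D}_0(s,t,q,u)=\sum_{n\ge1}\hat D_{2n}(s,t,q)\frac{u^{2n}}{D_{2n}(1,q)},\qquad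 \widehat{\mathcal D}_1(s,t,q,u)=\sum_{n\ge1}\hat D_{2n+1}(s,t,q)\frac{u^{2n+1}}{D_{2n+1}(1,q)}.$$ Let $[n]_q=1+q+\cdots+q^{n-1}$, $[n]_q!=\prod_{i=1}^n[i]_q$, $\mathrm{e}_q(u)=\sum_{n\ge0}u^n/[n]_q!$ and $\exp_D(u;q)=\sum_{n\ge0}u^n/D_n(1,q)$. With $i^2=-1$, let $$\cos_q(u)=\tfrac12(\mathrm{e}_q(iu)+\mathrm{e}_q(-iu)),\quad \sin_q(u)=\tfrac1{2i}(\mathrm{e}_q(iu)-\mathrm{e}_q(-iu)),$$ $$\cos_D(u;q)=\tfrac12(\exp_D(iu;q)+\exp_D(-iu;q)),\quad \sin_D(u;q)=\tfrac1{2i}(\exp_D(iu;q)-\exp_D(-iu;q)).$$ Let $M$ be a square root of $(1-s)(1-t)$, fix a square root $\sqrt s$ of $s$, and set $$T'(\mathrm{OD})=\sqrt s\,ut^2(\cos_q(Mu)-1)-\frac{(1-t)M\sqrt s}{s-1}(\sin_D(Mu;q)-Mu)+\frac{2t(1-t)\sqrt s}{M}(\sin_q(Mu)-Mu),$$ $$T'(\mathrm{ED})=2t(\cos_q(Mu)-1)+\frac{ut^2(s-1)}{M}\sin_q(Mu)+(1-t)(\cos_D(Mu;q)-1).$$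 **Theorem.** As formal power series in $u$, the denominators below being invertible, $$\widehat{\mathcal D}_0(s,t,q,u)=\frac{T'(\mathrm{ED})\,(1-t\cos_q(Mu))+T'(\mathrm{OD})\,\frac{t(s-1)\sqrt s}{Ms}\sin_q(Mu)}{s-(st+1)\cos_q(Mu)+t\,\mathrm{e}_q(iMu)\,\mathrm{e}_q(-iMu)},$$ $$\widehat{\mathcal D}_1(s,t,q,u)=\frac{\frac{T'(\mathrm{OD})}{\sqrt s}(s-\cos_q(Mu))+T'(\mathrm{ED})\,\frac{1-t}{M}\sin_q(Mu)}{s-(st+1)\cos_q(Mu)+t\,\mathrm{e}_q(iMu)\,\mathrm{e}_q(-iMu)}.$$ Here $s,t,q$ may be indeterminates or, more generally, any elements of a field of characteristic $0$ containing $i$, $\sqrt s$ and $M$, provided $s\ne0$, $s\ne1$, $t\ne1$ and no $[n]_q$ ($n\ge1$) and no $D_n(1,q)$ vanishes. -/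

import Mathlib

open PowerSeries

namespace TypeD

noncomputable section

/-- A signed permutation of `[n]`: the pair `(σ, ε)` is the signed permutation
`π_1, …, π_n` whose entry in position `i` has absolute value `σ(i)` and sign `ε(i)`. -/
abbrev SignedPerm (n : ℕ) : Type := Equiv.Perm (Fin n) × (Fin n → ℤˣ)

/-- The value `π_i = π(i)` for `i ∈ {±1, …, ±n}`, with `π(-i) = -π(i)`; it is `0` for all
other `i`. (`Fin n` is zero-based, positions and values are one-based.) -/
def SignedPerm.val {n : ℕ} (π : SignedPerm n) (i : ℤ) : ℤ :=
  if h : 1 ≤ i.natAbs ∧ i.natAbs ≤ n then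
    i.sign * ((π.2 ⟨i.natAbs - 1, by omega⟩ : ℤˣ) : ℤ) *
      (((π.1 ⟨i.natAbs - 1, by omega⟩ : Fin n) : ℕ) + 1 : ℤ)
  else 0

/-- `𝔇_n`: the signed permutations with an even number of negative entries. -/
def group (n : ℕ) : Finset (SignedPerm n) :=
  Finset.univ.filter fun π =>
    Even ((Finset.Icc (1 : ℤ) n).filter fun i => π.val i < 0).card

/-- The positions `{-1, 1, 2, …, n-1}`. -/
def positions (n : ℕ) : Finset ℤ := (Finset.Icc (-1 : ℤ) ((n : ℤ) - 1)).erase 0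

/-- `des_D(π)`: number of `i ∈ {-1, 1, …, n-1}` with `π_i > π_{|i|+1}`. -/
def des {n : ℕ} (π : SignedPerm n) : ℕ :=
  ((positions n).filter fun i => π.val i > π.val (|i| + 1)).card

/-- `odes_D(π)`: number of descents at odd positions, `-1` included. -/
def odes {n : ℕ} (π : SignedPerm n) : ℕ :=
  ((positions n).filter fun i => Odd i ∧ π.val i > π.val (|i| + 1)).card

/-- `easc_D(π)`: number of ascents at even positions. -/
def easc {n : ℕ} (π : SignedPerm n) : ℕ :=
  ((positions n).filter fun i => Even i ∧ π.val i < π.val (|i| + 1)).card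

/-- `inv_D(π)`: number of pairs `1 ≤ i < j ≤ n` with `π_i > π_j`, plus the number of those
with `-π_i > π_j`. -/
def inv {n : ℕ} (π : SignedPerm n) : ℕ :=
  ((Finset.Icc (1 : ℤ) n ×ˢ Finset.Icc (1 : ℤ) n).filter fun p =>
      p.1 < p.2 ∧ π.val p.1 > π.val p.2).card +
    ((Finset.Icc (1 : ℤ) n ×ˢ Finset.Icc (1 : ℤ) n).filter fun p =>
      p.1 < p.2 ∧ -π.val p.1 > π.val p.2).card

section Poly

variable {K : Type*} [Field K]

/-- `D_n(t,q) = ∑ t^{des_D(π)} q^{inv_D(π)}` over `𝔇_n`. -/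
def poly (n : ℕ) (t q : K) : K := ∑ π ∈ group n, t ^ des π * q ^ inv π

/-- `D̂_n(s,t,q) = ∑ t^{odes_D(π)} s^{easc_D(π)} q^{inv_D(π)}` over `𝔇_n`. -/
def altPoly (n : ℕ) (s t q : K) : K :=
  ∑ π ∈ group n, t ^ odes π * s ^ easc π * q ^ inv π

/-- `[n]_q = 1 + q + ⋯ + q^{n-1}`. -/
def qNat (q : K) (n : ℕ) : K := ∑ i ∈ Finset.range n, q ^ i

/-- `[n]_q! = [1]_q [2]_q ⋯ [n]_q`. -/
def qFact (q : K) (n : ℕ) : K := ∏ i ∈ Finset.Icc 1 n, qNat q i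

end Poly

/-! Formal power series over `K`; the variable `u` is `X`, and `f(cu)` is `rescale c f`. -/

section Series

variable {K : Type*} [Field K]

/-- `e_q(u) = ∑_{n ≥ 0} u^n / [n]_q!`. -/
def expQ (q : K) : K⟦X⟧ := PowerSeries.mk fun n => 1 / qFact q n

/-- `exp_D(u;q) = ∑_{n ≥ 0} u^n / D_n(1,q)`. -/
def expD (q : K) : K⟦X⟧ := PowerSeries.mk fun n => 1 / poly n 1 q

/-- `(f(ιu) + f(-ιu)) / 2`, where `ι` is a square root of `-1`. -/
def cosOf (ι : K) (f : K⟦X⟧) : K⟦X⟧ := C (1 / 2) * (rescale ι f + rescale (-ι) f)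

/-- `(f(ιu) - f(-ιu)) / (2ι)`, where `ι` is a square root of `-1`. -/
def sinOf (ι : K) (f : K⟦X⟧) : K⟦X⟧ := C (1 / (2 * ι)) * (rescale ι f - rescale (-ι) f)

/-- `cos_q(u)`. -/
def cosQ (ι q : K) : K⟦X⟧ := cosOf ι (expQ q)

/-- `sin_q(u)`. -/
def sinQ (ι q : K) : K⟦X⟧ := sinOf ι (expQ q)

/-- `cos_D(u;q)`. -/
def cosD (ι q : K) : K⟦X⟧ := cosOf ι (expD q)

/-- `sin_D(u;q)`. -/
def sinD (ι q : K) : K⟦X⟧ := sinOf ι (expD q)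

/-- `∑_{n ≥ 1} D̂_{2n}(s,t,q) u^{2n} / D_{2n}(1,q)`. -/
def altEgfEven (s t q : K) : K⟦X⟧ :=
  PowerSeries.mk fun m => if Even m ∧ 2 ≤ m then altPoly m s t q / poly m 1 q else 0

/-- `∑_{n ≥ 1} D̂_{2n+1}(s,t,q) u^{2n+1} / D_{2n+1}(1,q)`. -/
def altEgfOdd (s t q : K) : K⟦X⟧ :=
  PowerSeries.mk fun m => if Odd m ∧ 3 ≤ m then altPoly m s t q / poly m 1 q else 0

/-- `T'(OD)`, where `M` is a square root of `(1-s)(1-t)` and `r` is a square root of `s`. -/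
def transOD (ι M r s t q : K) : K⟦X⟧ :=
  C (r * t ^ 2) * X * (rescale M (cosQ ι q) - 1)
    - C ((1 - t) * M * r / (s - 1)) * (rescale M (sinD ι q) - C M * X)
    + C (2 * t * (1 - t) * r / M) * (rescale M (sinQ ι q) - C M * X)

/-- `T'(ED)`, where `M` is a square root of `(1-s)(1-t)`. -/
def transED (ι M s t q : K) : K⟦X⟧ :=
  C (2 * t) * (rescale M (cosQ ι q) - 1)
    + C (t ^ 2 * (s - 1) / M) * X * rescale M (sinQ ι q)
    + C (1 - t) * (rescale M (cosD ι q) - 1)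

/-- The common denominator `s - (st+1) cos_q(Mu) + t e_q(iMu) e_q(-iMu)`. -/
def altDenom (ι M s t q : K) : K⟦X⟧ :=
  C s - C (s * t + 1) * rescale M (cosQ ι q)
    + C t * rescale (ι * M) (expQ q) * rescale (-(ι * M)) (expQ q)

end Series

end

end TypeD

namespace TypeD

/-- The `i`-th letter (zero-based) of a signed permutation. -/
def SignedPerm.word {n : ℕ} (π : SignedPerm n) (i : Fin n) : ℤ :=
  ((π.2 i : ℤˣ) : ℤ) * (((π.1 i : Fin n) : ℕ) + 1 : ℤ)

theorem val_units_mul {n : ℕ} (π : SignedPerm n) (u : ℤˣ) (k : Fin n) :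
    π.val (u * ((k : ℕ) + 1 : ℤ)) = u * π.word k := by
  have habs : (u * ((k : ℕ) + 1 : ℤ)).natAbs = k + 1 := by
    rw [Int.natAbs_mul, Int.units_natAbs, one_mul]; omega
  have hsign : (u * ((k : ℕ) + 1 : ℤ)).sign = u := by
    rw [Int.sign_mul, Int.sign_eq_one_of_pos (a := ((k : ℕ) + 1 : ℤ)) (by omega), mul_one]
    rcases Int.units_eq_one_or u with rfl | rfl <;> rfl
  have hk : k.val < n := k.2
  have hidx : ∀ h, (⟨(u * ((k : ℕ) + 1 : ℤ)).natAbs - 1, h⟩ : Fin n) = k := by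
    intro h; ext; simp only [habs]; omega
  rw [SignedPerm.val, dif_pos (by rw [habs]; omega), hsign, hidx, mul_assoc, SignedPerm.word]

theorem val_succ {n : ℕ} (π : SignedPerm n) (k : Fin n) :
    π.val ((k : ℕ) + 1 : ℤ) = π.word k := by
  simpa using val_units_mul π 1 k

theorem exists_units_mul {n : ℕ} {i : ℤ} (h1 : 1 ≤ i.natAbs) (h2 : i.natAbs ≤ n) :
    ∃ (u : ℤˣ) (k : Fin n), i = u * ((k : ℕ) + 1 : ℤ) := by
  rcases Int.natAbs_eq i with h | h
  · exact ⟨1, ⟨i.natAbs - 1, by omega⟩, by rw [Units.val_one]; push_cast; omega⟩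
  · exact ⟨-1, ⟨i.natAbs - 1, by omega⟩, by
      rw [Units.val_neg, Units.val_one]; push_cast; omega⟩

theorem natAbs_word {n : ℕ} (π : SignedPerm n) (i : Fin n) :
    (π.word i).natAbs = (π.1 i : ℕ) + 1 := by
  rw [SignedPerm.word, Int.natAbs_mul, Int.units_natAbs, one_mul]; omega

theorem natAbs_word_injective {n : ℕ} (π : SignedPerm n) :
    Function.Injective fun i => (π.word i).natAbs := by
  intro i j h
  simp only [natAbs_word, add_left_inj] at h
  exact π.1.injective (Fin.ext h)

theorem word_injective {n : ℕ} (π : SignedPerm n) : Function.Injective π.word :=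
  fun _ _ h => natAbs_word_injective π (congrArg Int.natAbs h)

theorem sum_Icc_one_int {M : Type*} [AddCommMonoid M] (n : ℕ) (f : ℤ → M) :
    ∑ i ∈ Finset.Icc (1 : ℤ) n, f i = ∑ k : Fin n, f ((k : ℕ) + 1 : ℤ) := by
  symm
  refine Finset.sum_bij (fun k _ => ((k : ℕ) + 1 : ℤ)) ?_ ?_ ?_ ?_
  · intro k _
    have := k.2
    simp only [Finset.mem_Icc]; omega
  · intro a _ b _ h
    ext; omega
  · intro b hb
    simp only [Finset.mem_Icc] at hb
    exact ⟨⟨b.toNat - 1, by omega⟩, Finset.mem_univ _, by push_cast; omega⟩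
  · intros; rfl

/-- The contribution to `inv_D` of an entry `x` followed, at some distance, by `y`. -/
def invPair (x y : ℤ) : ℕ := (if y < x then 1 else 0) + (if y < -x then 1 else 0)

/-- `inv_D` of an arbitrary word of integers. -/
def wordInv {n : ℕ} (w : Fin n → ℤ) : ℕ :=
  ∑ i, ∑ j, if i < j then invPair (w i) (w j) else 0

theorem inv_eq_wordInv {n : ℕ} (π : SignedPerm n) : inv π = wordInv π.word := by
  simp only [inv, wordInv, Finset.card_filter, Finset.sum_product, sum_Icc_one_int, val_succ,
    ← Finset.sum_add_distrib]
  refine Finset.sum_congr rfl fun i _ => Finset.sum_congr rfl fun j _ => ?_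
  by_cases h : i < j
  · have h' : ((i : ℕ) + 1 : ℤ) < ((j : ℕ) + 1 : ℤ) := by
      have : i.val < j.val := h
      omega
    simp [h, h', invPair]
  · have h' : ¬ ((i : ℕ) + 1 : ℤ) < ((j : ℕ) + 1 : ℤ) := by
      have : ¬ i.val < j.val := h
      omega
    simp [h]

theorem even_card_neg_iff {n : ℕ} (π : SignedPerm n) :
    Even ((Finset.Icc (1 : ℤ) n).filter fun i => π.val i < 0).card ↔ ∏ i, π.2 i = 1 := by
  have hterm : ∀ i : Fin n, π.2 i = (-1 : ℤˣ) ^ (if π.word i < 0 then 1 else 0) := by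
    intro i
    rw [SignedPerm.word]
    rcases Int.units_eq_one_or (π.2 i) with h | h <;> rw [h]
    · rw [if_neg (by push_cast; omega), pow_zero]
    · rw [if_pos (by push_cast; omega), pow_one]
  have : ∏ i, π.2 i = (-1 : ℤˣ) ^ ((Finset.Icc (1 : ℤ) n).filter fun i => π.val i < 0).card := by
    rw [Finset.card_filter, sum_Icc_one_int, Finset.prod_congr rfl fun i _ => hterm i,
      Finset.prod_pow_eq_pow_sum]
    simp only [val_succ]
  rw [this]
  constructor
  · intro h; exact h.neg_one_pow
  · intro h
    by_contra h'
    rw [Nat.not_even_iff_odd] at h'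
    rw [h'.neg_one_pow] at h
    exact absurd h (by decide)

section Flip

/-- Negate the first entry. -/
def flipFirst {n : ℕ} (π : SignedPerm (n + 1)) : SignedPerm (n + 1) :=
  (π.1, Function.update π.2 0 (-π.2 0))

theorem flipFirst_flipFirst {n : ℕ} (π : SignedPerm (n + 1)) : flipFirst (flipFirst π) = π := by
  simp [flipFirst]

/-- Negating the first entry, as a bijection. -/
def flipFirstEquiv (n : ℕ) : SignedPerm (n + 1) ≃ SignedPerm (n + 1) :=
  ⟨flipFirst, flipFirst, flipFirst_flipFirst, flipFirst_flipFirst⟩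

theorem word_flipFirst_zero {n : ℕ} (π : SignedPerm (n + 1)) :
    (flipFirst π).word 0 = -π.word 0 := by
  simp [flipFirst, SignedPerm.word]

theorem word_flipFirst_succ {n : ℕ} (π : SignedPerm (n + 1)) (i : Fin n) :
    (flipFirst π).word i.succ = π.word i.succ := by
  simp [flipFirst, SignedPerm.word]

theorem val_flipFirst_of_two_le {n : ℕ} (π : SignedPerm (n + 1)) {i : ℤ} (hi : 2 ≤ i) :
    (flipFirst π).val i = π.val i := by
  by_cases h : i ≤ (n + 1 : ℕ)
  · have : i = (((⟨i.toNat - 2, by omega⟩ : Fin n).succ : Fin (n + 1)) : ℕ) + 1 := by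
      simp only [Fin.val_succ]; push_cast; omega
    rw [this, val_succ, val_succ, word_flipFirst_succ]
  · rw [SignedPerm.val, SignedPerm.val, dif_neg (by omega), dif_neg (by omega)]

theorem val_one {n : ℕ} (π : SignedPerm (n + 1)) : π.val 1 = π.word 0 := by
  simpa using val_succ π 0

theorem val_neg_one {n : ℕ} (π : SignedPerm (n + 1)) : π.val (-1) = -π.word 0 := by
  simpa using val_units_mul π (-1) 0

theorem invPair_neg_left (x y : ℤ) : invPair (-x) y = invPair x y := by
  simp only [invPair, neg_neg]; ring

theorem wordInv_succ {n : ℕ} (w : Fin (n + 1) → ℤ) :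
    wordInv w = ∑ j : Fin n, invPair (w 0) (w j.succ) + wordInv fun j => w j.succ := by
  simp [wordInv, Fin.sum_univ_succ]

theorem inv_flipFirst {n : ℕ} (π : SignedPerm (n + 1)) : inv (flipFirst π) = inv π := by
  simp only [inv_eq_wordInv, wordInv_succ, word_flipFirst_zero, word_flipFirst_succ,
    invPair_neg_left]

theorem prod_flipFirst {n : ℕ} (π : SignedPerm (n + 1)) :
    ∏ i, (flipFirst π).2 i = -∏ i, π.2 i := by
  simp [flipFirst, Fin.prod_univ_succ]

theorem sum_univ_eq_two_mul_sum_group {K : Type*} [Field K] {n : ℕ}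
    (f : SignedPerm (n + 1) → K) (hf : ∀ π, f (flipFirst π) = f π) :
    ∑ π, f π = 2 * ∑ π ∈ group (n + 1), f π := by
  have hg : group (n + 1) = Finset.univ.filter fun π => ∏ i, π.2 i = 1 := by
    simp only [group, even_card_neg_iff]
  have hneg : ∑ π : SignedPerm (n + 1) with ¬ ∏ i, π.2 i = 1, f π =
      ∑ π : SignedPerm (n + 1) with ∏ i, π.2 i = 1, f π := by
    rw [Finset.sum_filter, Finset.sum_filter, ← Equiv.sum_comp (flipFirstEquiv n)]
    refine Finset.sum_congr rfl fun π _ => ?_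
    change (if ¬ ∏ i, (flipFirst π).2 i = 1 then f (flipFirst π) else 0) = _
    rw [prod_flipFirst, hf]
    rcases Int.units_eq_one_or (∏ i, π.2 i) with h | h <;> rw [h] <;> simp
  rw [← Finset.sum_filter_add_sum_filter_not Finset.univ (fun π => ∏ i, π.2 i = 1), hneg, ← hg,
    two_mul]

end Flip

section Extend

/-- The permutation of `n + 1` letters with last value `p` whose other values are in the same
relative order as those of `e`. -/
noncomputable def extendPerm {n : ℕ} (p : Fin (n + 1)) (e : Equiv.Perm (Fin n)) : Equiv.Perm (Fin (n + 1)) :=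
  Equiv.ofBijective (Fin.snoc (α := fun _ => Fin (n + 1)) (fun i => p.succAbove (e i)) p) <| by
    rw [← Finite.injective_iff_bijective]
    intro i j
    refine Fin.lastCases ?_ (fun i => ?_) i <;> refine Fin.lastCases ?_ (fun j => ?_) j
    · simp
    · simp [Fin.ne_succAbove]
    · simp [Fin.succAbove_ne]
    · simp

@[simp] theorem extendPerm_last {n : ℕ} (p : Fin (n + 1)) (e : Equiv.Perm (Fin n)) :
    extendPerm p e (Fin.last n) = p := by
  simp [extendPerm]

@[simp] theorem extendPerm_castSucc {n : ℕ} (p : Fin (n + 1)) (e : Equiv.Perm (Fin n))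
    (i : Fin n) : extendPerm p e i.castSucc = p.succAbove (e i) := by
  simp [extendPerm]

theorem extendPerm_injective (n : ℕ) :
    Function.Injective fun x : Fin (n + 1) × Equiv.Perm (Fin n) => extendPerm x.1 x.2 := by
  rintro ⟨p, e⟩ ⟨p', e'⟩ h
  simp only at h
  obtain rfl : p = p' := by simpa using DFunLike.congr_fun h (Fin.last n)
  have : e = e' := by
    ext i
    have := DFunLike.congr_fun h i.castSucc
    rw [extendPerm_castSucc, extendPerm_castSucc, Fin.succAbove_right_inj] at this
    rw [this]
  rw [this]

/-- A permutation of `n + 1` letters amounts to its last value and the pattern of the rest. -/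
noncomputable def extendPermEquiv (n : ℕ) : Fin (n + 1) × Equiv.Perm (Fin n) ≃ Equiv.Perm (Fin (n + 1)) :=
  Equiv.ofBijective _ <| (Fintype.bijective_iff_injective_and_card _).2
    ⟨extendPerm_injective n, by simp [Fintype.card_perm, Nat.factorial_succ]⟩

/-- The signed permutation with last entry `± (p + 1)`, of sign `δ`, whose other entries form
the pattern `π`. -/
noncomputable def extend {n : ℕ} (p : Fin (n + 1)) (δ : ℤˣ) (π : SignedPerm n) : SignedPerm (n + 1) :=
  (extendPerm p π.1, Fin.snoc (α := fun _ => ℤˣ) π.2 δ)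

/-- A signed permutation amounts to its last entry and the pattern of the rest. -/
noncomputable def extendEquiv (n : ℕ) : (Fin (n + 1) × ℤˣ) × SignedPerm n ≃ SignedPerm (n + 1) :=
  (Equiv.prodProdProdComm (Fin (n + 1)) ℤˣ (Equiv.Perm (Fin n)) (Fin n → ℤˣ)).trans
    (Equiv.prodCongr (extendPermEquiv n) (Fin.snocEquiv fun _ => ℤˣ))

theorem extendEquiv_apply {n : ℕ} (p : Fin (n + 1)) (δ : ℤˣ) (π : SignedPerm n) :
    extendEquiv n ((p, δ), π) = extend p δ π := rfl

theorem word_extend_last {n : ℕ} (p : Fin (n + 1)) (δ : ℤˣ) (π : SignedPerm n) :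
    (extend p δ π).word (Fin.last n) = δ * ((p : ℕ) + 1 : ℤ) := by
  simp [extend, SignedPerm.word]

theorem word_extend_castSucc {n : ℕ} (p : Fin (n + 1)) (δ : ℤˣ) (π : SignedPerm n) (i : Fin n) :
    (extend p δ π).word i.castSucc = π.2 i * ((p.succAbove (π.1 i) : ℕ) + 1 : ℤ) := by
  simp [extend, SignedPerm.word]

theorem units_mul_succAbove_lt_iff {n : ℕ} (p : Fin (n + 1)) (u v : ℤˣ) (a b : Fin n) :
    (u * ((p.succAbove a : ℕ) + 1 : ℤ) < v * ((p.succAbove b : ℕ) + 1 : ℤ)) ↔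
      (u * ((a : ℕ) + 1 : ℤ) < v * ((b : ℕ) + 1 : ℤ)) := by
  have h1 : ((p.succAbove a : ℕ) < p.succAbove b) ↔ ((a : ℕ) < b) := by
    simp
  have h2 : ((p.succAbove b : ℕ) < p.succAbove a) ↔ ((b : ℕ) < a) := by
    simp
  rcases Int.units_eq_one_or u with rfl | rfl <;> rcases Int.units_eq_one_or v with rfl | rfl <;>
    push_cast <;> omega

theorem units_mul_word_extend_lt_iff {n : ℕ} (p : Fin (n + 1)) (δ : ℤˣ) (π : SignedPerm n)
    (u v : ℤˣ) (i j : Fin n) :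
    (u * (extend p δ π).word i.castSucc < v * (extend p δ π).word j.castSucc) ↔
      (u * π.word i < v * π.word j) := by
  have h := units_mul_succAbove_lt_iff p (u * π.2 i) (v * π.2 j) (π.1 i) (π.1 j)
  rw [word_extend_castSucc, word_extend_castSucc]
  simpa only [SignedPerm.word, Units.val_mul, mul_assoc] using h

theorem val_extend_lt_iff {n : ℕ} (p : Fin (n + 1)) (δ : ℤˣ) (π : SignedPerm n) {i j : ℤ}
    (hi : 1 ≤ i.natAbs) (hi' : i.natAbs ≤ n) (hj : 1 ≤ j.natAbs) (hj' : j.natAbs ≤ n) :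
    (extend p δ π).val i < (extend p δ π).val j ↔ π.val i < π.val j := by
  obtain ⟨u, k, rfl⟩ := exists_units_mul hi hi'
  obtain ⟨v, l, rfl⟩ := exists_units_mul hj hj'
  have h := units_mul_word_extend_lt_iff p δ π u v k l
  rw [← val_units_mul, ← val_units_mul, ← val_units_mul, ← val_units_mul] at h
  exact h

theorem invPair_word_extend {n : ℕ} (p : Fin (n + 1)) (δ : ℤˣ) (π : SignedPerm n) (i j : Fin n) :
    invPair ((extend p δ π).word i.castSucc) ((extend p δ π).word j.castSucc) =
      invPair (π.word i) (π.word j) := by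
  have h1 := units_mul_word_extend_lt_iff p δ π 1 1 j i
  have h2 := units_mul_word_extend_lt_iff p δ π 1 (-1) j i
  simp only [Units.val_one, one_mul, Units.val_neg, neg_mul] at h1 h2
  simp only [invPair, h1, h2]

theorem wordInv_castSucc {n : ℕ} (w : Fin (n + 1) → ℤ) :
    wordInv w = wordInv (fun j => w j.castSucc) +
      ∑ j : Fin n, invPair (w j.castSucc) (w (Fin.last n)) := by
  have h : ∀ i : Fin n, ¬ Fin.last n < i.castSucc := fun i => (Fin.le_last _).not_gt
  simp [wordInv, Fin.sum_univ_castSucc, Fin.castSucc_lt_last, h, Finset.sum_add_distrib]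

theorem invPair_units_mul_left (u : ℤˣ) (x y : ℤ) : invPair (u * x) y = invPair x y := by
  rcases Int.units_eq_one_or u with rfl | rfl
  · simp
  · simp [invPair_neg_left]

/-- The contribution to `inv_D` of the last entry. -/
def lastInv {n : ℕ} (x : Fin (n + 1) × ℤˣ) : ℕ :=
  ∑ j : Fin n, invPair ((x.1.succAbove j : ℕ) + 1 : ℤ) (x.2 * ((x.1 : ℕ) + 1 : ℤ))

theorem inv_extend {n : ℕ} (p : Fin (n + 1)) (δ : ℤˣ) (π : SignedPerm n) :
    inv (extend p δ π) = inv π + lastInv (p, δ) := by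
  rw [inv_eq_wordInv, inv_eq_wordInv, wordInv_castSucc]
  congr 1
  · simp only [wordInv, invPair_word_extend]
  · simp only [word_extend_castSucc, word_extend_last, invPair_units_mul_left, lastInv]
    exact Equiv.sum_comp π.1 fun j =>
      invPair ((p.succAbove j : ℕ) + 1 : ℤ) (δ * ((p : ℕ) + 1 : ℤ))

/-- Statistics of the pattern of the first `n` entries factor out of the sum over signed
permutations of `n + 1` letters. -/
theorem sum_extend {K : Type*} [Field K] (q : K) {n : ℕ} (f : SignedPerm (n + 1) → K)
    (g : SignedPerm n → K) (hfg : ∀ p δ π, f (extend p δ π) = g π) :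
    ∑ π, f π * q ^ inv π =
      (∑ x : Fin (n + 1) × ℤˣ, q ^ lastInv x) * ∑ π, g π * q ^ inv π := by
  rw [← Equiv.sum_comp (extendEquiv n), Fintype.sum_prod_type, Finset.sum_mul_sum]
  refine Finset.sum_congr rfl fun x _ => Finset.sum_congr rfl fun π _ => ?_
  rw [extendEquiv_apply, hfg, inv_extend, pow_add]
  ring

end Extend

section PermInversions

/-- The number of inversions of a permutation. -/
def permInv {k : ℕ} (τ : Equiv.Perm (Fin k)) : ℕ :=
  ∑ i, ∑ j, if i < j then (if τ j < τ i then 1 else 0) else 0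

theorem permInv_extendPerm {k : ℕ} (p : Fin (k + 1)) (e : Equiv.Perm (Fin k)) :
    permInv (extendPerm p e) = permInv e + (k - p) := by
  have h : ∀ i : Fin k, ¬ Fin.last k < i.castSucc := fun i => (Fin.le_last _).not_gt
  have hcard : ∑ i : Fin k, (if p < p.succAbove (e i) then 1 else 0) = k - (p : ℕ) := by
    rw [Equiv.sum_comp e fun i => if p < p.succAbove i then 1 else 0]
    have h1 : ∀ i : Fin k, p < p.succAbove i ↔ (p : ℕ) ≤ i := by
      intro i
      rw [Fin.lt_succAbove_iff_le_castSucc, Fin.le_def]; rfl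
    simp only [h1]
    rw [Fin.sum_univ_eq_sum_range (fun i => if (p : ℕ) ≤ i then 1 else 0) k,
      ← Finset.card_filter]
    have : (Finset.range k).filter (fun i => (p : ℕ) ≤ i) = Finset.Ico (p : ℕ) k := by
      ext; simp; tauto
    rw [this, Nat.card_Ico]
  rw [← hcard]
  simp [permInv, Fin.sum_univ_castSucc, Fin.castSucc_lt_last, h, Finset.sum_add_distrib,
    -Finset.sum_boole]

theorem sum_pow_permInv {K : Type*} [Field K] (q : K) (k : ℕ) :
    ∑ τ : Equiv.Perm (Fin k), q ^ permInv τ = qFact q k := by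
  induction k with
  | zero => simp [permInv, qFact]
  | succ k ih =>
    have hq : ∑ p : Fin (k + 1), q ^ (k - (p : ℕ)) = qNat q (k + 1) := by
      rw [Fin.sum_univ_eq_sum_range (fun i => q ^ (k - i)) (k + 1), qNat,
        ← Finset.sum_range_reflect]
      refine Finset.sum_congr rfl fun i hi => ?_
      rw [Finset.mem_range] at hi
      congr 1
      omega
    rw [← Equiv.sum_comp (extendPermEquiv k), Fintype.sum_prod_type]
    change ∑ p, ∑ e, q ^ permInv (extendPerm p e) = _
    simp only [permInv_extendPerm, pow_add]
    rw [Finset.sum_comm, ← Finset.sum_mul_sum, ih, hq, qFact, qFact,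
      Finset.prod_Icc_succ_top (by omega)]

end PermInversions

section SortTail

theorem sum_lt_comp_perm {k : ℕ} (f : Fin k → Fin k → ℕ) (hf : ∀ i j, f i j = f j i)
    (τ : Equiv.Perm (Fin k)) :
    ∑ i, ∑ j, (if i < j then f (τ i) (τ j) else 0) = ∑ i, ∑ j, if i < j then f i j else 0 := by
  have key : ∀ g : Fin k → Fin k → ℕ, (∀ i j, g i j = g j i) →
      ∑ i, ∑ j, g i j = 2 * (∑ i, ∑ j, if i < j then g i j else 0) + ∑ i, g i i := by
    intro g hg
    have h1 : ∀ i j, g i j = (if i < j then g i j else 0) + (if j < i then g j i else 0) +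
        (if i = j then g i j else 0) := by
      intro i j
      rcases lt_trichotomy i j with h | h | h
      · simp [h, h.not_gt, h.ne]
      · simp [h]
      · simp [h, h.not_gt, h.ne', hg i j]
    have h2 : ∑ i, ∑ j, (if j < i then g j i else 0) = ∑ i, ∑ j, if i < j then g i j else 0 :=
      Finset.sum_comm
    calc ∑ i, ∑ j, g i j = ∑ i, ∑ j, ((if i < j then g i j else 0) +
          (if j < i then g j i else 0) + (if i = j then g i j else 0)) :=
          Finset.sum_congr rfl fun i _ => Finset.sum_congr rfl fun j _ => h1 i j
      _ = _ := by
          simp only [Finset.sum_add_distrib, h2]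
          simp [two_mul]
  have h1 := key f hf
  have h2 := key (fun i j => f (τ i) (τ j)) fun i j => hf _ _
  have h3 : ∑ i, ∑ j, f (τ i) (τ j) = ∑ i, ∑ j, f i j := by
    rw [← Equiv.sum_comp τ fun i => ∑ j, f i j]
    exact Finset.sum_congr rfl fun i _ => Equiv.sum_comp τ fun j => f (τ i) j
  have h4 : ∑ i, f (τ i) (τ i) = ∑ i, f i i := Equiv.sum_comp τ fun i => f i i
  omega

theorem wordInv_comp_perm {k : ℕ} {b : Fin k → ℤ} (hb : StrictMono b) (τ : Equiv.Perm (Fin k)) :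
    wordInv (fun i => b (τ i)) = wordInv b + permInv τ := by
  have hsplit : ∀ c : Fin k → ℤ, wordInv c =
      (∑ i, ∑ j, if i < j then (if c j < c i then 1 else 0) else 0) +
        ∑ i, ∑ j, if i < j then (if c j < -c i then 1 else 0) else 0 := by
    intro c
    simp only [wordInv, ← Finset.sum_add_distrib]
    refine Finset.sum_congr rfl fun i _ => Finset.sum_congr rfl fun j _ => ?_
    split_ifs <;> simp [invPair, *]
  have hzero : (∑ i, ∑ j, if i < j then (if b j < b i then 1 else 0) else 0) = 0 := by
    refine Finset.sum_eq_zero fun i _ => Finset.sum_eq_zero fun j _ => ?_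
    by_cases h : i < j
    · simp [h, (hb h).not_gt]
    · simp [h]
  have hsymm := sum_lt_comp_perm (fun i j => if b j < -b i then 1 else 0)
    (fun i j => if_congr (by omega) rfl rfl) τ
  rw [hsplit, hsplit b, hzero, hsymm, permInv]
  simp only [hb.lt_iff_lt]
  ring

theorem wordInv_append {m k : ℕ} (w : Fin (m + k) → ℤ) :
    wordInv w = wordInv (fun i => w (Fin.castAdd k i)) +
      (∑ i, ∑ j, invPair (w (Fin.castAdd k i)) (w (Fin.natAdd m j))) +
      wordInv (fun j => w (Fin.natAdd m j)) := by
  have h1 : ∀ (i : Fin m) (j : Fin k), Fin.castAdd k i < Fin.natAdd m j := by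
    intro i j; rw [Fin.lt_def, Fin.val_castAdd, Fin.val_natAdd]; omega
  have h2 : ∀ (i j : Fin m), Fin.castAdd k i < Fin.castAdd k j ↔ i < j := by
    intro i j; rw [Fin.lt_def, Fin.lt_def, Fin.val_castAdd, Fin.val_castAdd]
  have h3 : ∀ (i j : Fin k), Fin.natAdd m i < Fin.natAdd m j ↔ i < j := by
    intro i j; rw [Fin.lt_def, Fin.lt_def, Fin.val_natAdd, Fin.val_natAdd]; omega
  simp only [wordInv, Fin.sum_univ_add, h1, h2, h3, (h1 _ _).not_gt, if_true, if_false,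
    Finset.sum_const_zero, Finset.sum_add_distrib]
  ring

/-- Rearrange the entries of a signed permutation. -/
def rearrange {n : ℕ} (τ : Equiv.Perm (Fin n)) (π : SignedPerm n) : SignedPerm n :=
  (π.1 * τ, fun i => π.2 (τ i))

theorem word_rearrange {n : ℕ} (τ : Equiv.Perm (Fin n)) (π : SignedPerm n) (i : Fin n) :
    (rearrange τ π).word i = π.word (τ i) := rfl

theorem rearrange_rearrange {n : ℕ} (τ τ' : Equiv.Perm (Fin n)) (π : SignedPerm n) :
    rearrange τ (rearrange τ' π) = rearrange (τ' * τ) π := rfl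

/-- Rearranging entries, as a bijection. -/
def rearrangeEquiv {n : ℕ} (τ : Equiv.Perm (Fin n)) : SignedPerm n ≃ SignedPerm n where
  toFun := rearrange τ
  invFun := rearrange τ⁻¹
  left_inv π := by rw [rearrange_rearrange, mul_inv_cancel]; rfl
  right_inv π := by rw [rearrange_rearrange, inv_mul_cancel]; rfl

/-- A permutation of the last `k` of `m + k` positions. -/
def tailPerm (m : ℕ) {k : ℕ} (τ : Equiv.Perm (Fin k)) : Equiv.Perm (Fin (m + k)) :=
  finSumFinEquiv.permCongr (Equiv.Perm.sumCongr 1 τ)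

@[simp] theorem tailPerm_castAdd (m : ℕ) {k : ℕ} (τ : Equiv.Perm (Fin k)) (i : Fin m) :
    tailPerm m τ (Fin.castAdd k i) = Fin.castAdd k i := by
  simp [tailPerm, Equiv.permCongr_apply]

@[simp] theorem tailPerm_natAdd (m : ℕ) {k : ℕ} (τ : Equiv.Perm (Fin k)) (j : Fin k) :
    tailPerm m τ (Fin.natAdd m j) = Fin.natAdd m (τ j) := by
  simp [tailPerm, Equiv.permCongr_apply]

theorem tailPerm_mul_tailPerm_inv (m : ℕ) {k : ℕ} (τ : Equiv.Perm (Fin k)) :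
    tailPerm m τ * tailPerm m τ⁻¹ = 1 := by
  ext x
  refine Fin.addCases (fun i => ?_) (fun j => ?_) x <;> simp

/-- The last `k` entries of a signed permutation of `m + k` letters. -/
def tailWord (m : ℕ) {k : ℕ} (π : SignedPerm (m + k)) (j : Fin k) : ℤ := π.word (Fin.natAdd m j)

theorem tailWord_injective (m : ℕ) {k : ℕ} (π : SignedPerm (m + k)) :
    Function.Injective (tailWord m π) :=
  (word_injective π).comp (Fin.natAdd_injective k m)

theorem inv_rearrange_tailPerm {m k : ℕ} {π : SignedPerm (m + k)}
    (hπ : StrictMono (tailWord m π)) (τ : Equiv.Perm (Fin k)) :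
    inv (rearrange (tailPerm m τ) π) = inv π + permInv τ := by
  have h := wordInv_comp_perm hπ τ
  rw [show wordInv (tailWord m π) = wordInv fun j => π.word (Fin.natAdd m j) from rfl] at h
  simp only [tailWord] at h
  have h2 : ∀ i : Fin m, ∑ j, invPair (π.word (Fin.castAdd k i)) (π.word (Fin.natAdd m (τ j))) =
      ∑ j, invPair (π.word (Fin.castAdd k i)) (π.word (Fin.natAdd m j)) := fun i =>
    Equiv.sum_comp τ fun j => invPair (π.word (Fin.castAdd k i)) (π.word (Fin.natAdd m j))
  rw [inv_eq_wordInv, inv_eq_wordInv, wordInv_append, wordInv_append π.word]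
  simp only [word_rearrange, tailPerm_castAdd, tailPerm_natAdd, h, h2]
  ring

theorem card_strictMono_comp_perm {k : ℕ} {b : Fin k → ℤ} (hb : Function.Injective b) :
    (Finset.univ.filter fun τ : Equiv.Perm (Fin k) => StrictMono fun i => b (τ i)).card = 1 := by
  rw [Finset.card_eq_one]
  refine ⟨Tuple.sort b, ?_⟩
  ext τ
  simp only [Finset.mem_filter, Finset.mem_univ, true_and, Finset.mem_singleton]
  have hsort : StrictMono fun i => b (Tuple.sort b i) :=
    (Tuple.monotone_sort b).strictMono_of_injective (hb.comp (Tuple.sort b).injective)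
  constructor
  · intro h
    ext i
    have := congrFun (Tuple.unique_monotone h.monotone hsort.monotone) i
    exact congrArg Fin.val (hb this)
  · rintro rfl
    exact hsort

open Classical in
/-- The signed permutations with increasing last `k` entries represent the orbits of the
rearrangements of these entries. -/
theorem sum_eq_qFact_mul_sum_strictMono {K : Type*} [Field K] (q : K) {m k : ℕ}
    (g : SignedPerm (m + k) → K)
    (hg : ∀ (τ : Equiv.Perm (Fin k)) π, g (rearrange (tailPerm m τ) π) = g π) :
    ∑ π, g π * q ^ inv π =
      qFact q k * ∑ π, if StrictMono (tailWord m π) then g π * q ^ inv π else 0 := by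
  have hone : ∀ π : SignedPerm (m + k), ∑ τ : Equiv.Perm (Fin k),
      (if StrictMono (tailWord m (rearrange (tailPerm m τ⁻¹) π)) then (1 : K) else 0) = 1 := by
    intro π
    have h := card_strictMono_comp_perm (tailWord_injective m π)
    refine (Equiv.sum_comp (Equiv.inv (Equiv.Perm (Fin k))) fun τ =>
      if StrictMono (tailWord m (rearrange (tailPerm m τ) π)) then (1 : K) else 0).trans ?_
    have h2 : ∀ τ : Equiv.Perm (Fin k), tailWord m (rearrange (tailPerm m τ) π) =
        fun i => tailWord m π (τ i) := by
      intro τ; ext i; simp [tailWord, word_rearrange]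
    simp only [h2]
    rw [Finset.sum_boole]
    convert (congrArg (Nat.cast (R := K)) h) using 1
    simp
  calc ∑ π, g π * q ^ inv π
      = ∑ π, ∑ τ : Equiv.Perm (Fin k),
          (if StrictMono (tailWord m (rearrange (tailPerm m τ⁻¹) π)) then g π * q ^ inv π
            else 0) := by
        refine Finset.sum_congr rfl fun π _ => ?_
        conv_lhs => rw [← mul_one (g π * q ^ inv π), ← hone π, Finset.mul_sum]
        simp only [mul_ite, mul_one, mul_zero]
    _ = ∑ τ : Equiv.Perm (Fin k), ∑ π,
          (if StrictMono (tailWord m π) then g π * q ^ inv π else 0) * q ^ permInv τ := by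
        rw [Finset.sum_comm]
        refine Finset.sum_congr rfl fun τ _ => ?_
        rw [← Equiv.sum_comp (rearrangeEquiv (tailPerm m τ))]
        refine Finset.sum_congr rfl fun π _ => ?_
        change (if StrictMono (tailWord m (rearrange (tailPerm m τ⁻¹)
          (rearrange (tailPerm m τ) π))) then g (rearrange (tailPerm m τ) π) *
            q ^ inv (rearrange (tailPerm m τ) π) else 0) = _
        rw [rearrange_rearrange, tailPerm_mul_tailPerm_inv, hg]
        change (if StrictMono (tailWord m π) then _ else _) = _
        split_ifs with h
        · rw [inv_rearrange_tailPerm h, pow_add, mul_assoc]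
        · rw [zero_mul]
    _ = _ := by
        rw [Finset.sum_comm, ← Finset.sum_mul_sum, sum_pow_permInv, mul_comm]

end SortTail

section Weights

variable {K : Type*} [Field K]

/-- The factor of `t^{odes_D} s^{easc_D}` at the position `i`. -/
def posWeight (s t : K) {n : ℕ} (π : SignedPerm n) (i : ℤ) : K :=
  if Odd i then (if π.val i > π.val (|i| + 1) then t else 1)
  else (if π.val i < π.val (|i| + 1) then s else 1)

/-- The factor of `t^{odes_D} s^{easc_D}` at the positions `-1, 1, …, m - 1`. -/
noncomputable def prefixWeight (s t : K) (m : ℕ) {n : ℕ} (π : SignedPerm n) : K :=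
  ∏ i ∈ positions m, posWeight s t π i

theorem pow_odes_mul_pow_easc (s t : K) {n : ℕ} (π : SignedPerm n) :
    t ^ odes π * s ^ easc π = prefixWeight s t n π := by
  rw [odes, easc, ← Finset.prod_const, ← Finset.prod_const, Finset.prod_filter,
    Finset.prod_filter, ← Finset.prod_mul_distrib]
  refine Finset.prod_congr rfl fun i _ => ?_
  by_cases h : Odd i
  · have h' : ¬ Even i := Int.not_even_iff_odd.2 h
    simp [posWeight, h, h']
  · have h' : Even i := Int.not_odd_iff_even.1 h
    simp [posWeight, h, h']

theorem positions_succ {n : ℕ} (hn : 1 ≤ n) :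
    positions (n + 1) = insert (n : ℤ) (positions n) := by
  ext i
  simp only [positions, Finset.mem_erase, Finset.mem_Icc, Finset.mem_insert]
  push_cast
  omega

theorem prefixWeight_succ (s t : K) {m : ℕ} (hm : 1 ≤ m) {n : ℕ} (π : SignedPerm n) :
    prefixWeight s t (m + 1) π = prefixWeight s t m π * posWeight s t π m := by
  rw [prefixWeight, positions_succ hm, Finset.prod_insert, prefixWeight, mul_comm]
  simp [positions]

theorem prefixWeight_eq (s t : K) {m : ℕ} (hm : 2 ≤ m) {n : ℕ} (π : SignedPerm n) :
    prefixWeight s t m π =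
      posWeight s t π (-1) * posWeight s t π 1 * ∏ i ∈ Finset.Ico 2 m, posWeight s t π i := by
  induction m, hm using Nat.le_induction with
  | base =>
    rw [prefixWeight_succ s t le_rfl, prefixWeight]
    have : positions 1 = {-1} := by decide
    simp [this]
  | succ m hm ih =>
    rw [prefixWeight_succ s t (by omega), ih, Finset.prod_Ico_succ_top hm, mul_assoc]

theorem posWeight_congr (s t : K) {n n' : ℕ} {π : SignedPerm n} {π' : SignedPerm n'} {i : ℤ}
    (h1 : π.val (|i| + 1) < π.val i ↔ π'.val (|i| + 1) < π'.val i)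
    (h2 : π.val i < π.val (|i| + 1) ↔ π'.val i < π'.val (|i| + 1)) :
    posWeight s t π i = posWeight s t π' i := by
  simp only [posWeight, gt_iff_lt, h1, h2]

theorem natAbs_of_mem_positions {m : ℕ} (hm : 2 ≤ m) {i : ℤ} (hi : i ∈ positions m) :
    1 ≤ i.natAbs ∧ i.natAbs ≤ m ∧ 1 ≤ (|i| + 1).natAbs ∧ (|i| + 1).natAbs ≤ m := by
  simp only [positions, Finset.mem_erase, Finset.mem_Icc] at hi
  rw [Int.abs_eq_natAbs]
  omega

theorem prefixWeight_extend (s t : K) {m n : ℕ} (hm : 2 ≤ m) (hmn : m ≤ n) (p : Fin (n + 1))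
    (δ : ℤˣ) (π : SignedPerm n) :
    prefixWeight s t m (extend p δ π) = prefixWeight s t m π := by
  refine Finset.prod_congr rfl fun i hi => ?_
  obtain ⟨h1, h2, h3, h4⟩ := natAbs_of_mem_positions hm hi
  exact posWeight_congr s t (val_extend_lt_iff p δ π h3 (h4.trans hmn) h1 (h2.trans hmn))
    (val_extend_lt_iff p δ π h1 (h2.trans hmn) h3 (h4.trans hmn))

theorem val_rearrange_tailPerm {m k : ℕ} (τ : Equiv.Perm (Fin k)) (π : SignedPerm (m + k)) {i : ℤ}
    (h1 : 1 ≤ i.natAbs) (h2 : i.natAbs ≤ m) :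
    (rearrange (tailPerm m τ) π).val i = π.val i := by
  obtain ⟨u, j, rfl⟩ := exists_units_mul h1 h2
  have hj : (j : ℕ) = (Fin.castAdd k j : ℕ) := rfl
  rw [hj, val_units_mul, val_units_mul, word_rearrange, tailPerm_castAdd]

theorem prefixWeight_rearrange (s t : K) {m k : ℕ} (hm : 2 ≤ m) (τ : Equiv.Perm (Fin k))
    (π : SignedPerm (m + k)) :
    prefixWeight s t m (rearrange (tailPerm m τ) π) = prefixWeight s t m π := by
  refine Finset.prod_congr rfl fun i hi => ?_
  obtain ⟨h1, h2, h3, h4⟩ := natAbs_of_mem_positions hm hi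
  apply posWeight_congr <;>
    rw [val_rearrange_tailPerm τ π h1 h2, val_rearrange_tailPerm τ π h3 h4]

theorem val_flipFirst_one {n : ℕ} (π : SignedPerm (n + 1)) :
    (flipFirst π).val 1 = π.val (-1) := by
  rw [val_one, val_neg_one, word_flipFirst_zero]

theorem val_flipFirst_neg_one {n : ℕ} (π : SignedPerm (n + 1)) :
    (flipFirst π).val (-1) = π.val 1 := by
  rw [val_one, val_neg_one, word_flipFirst_zero, neg_neg]

theorem prefixWeight_flipFirst (s t : K) {m n : ℕ} (hm : 2 ≤ m) (π : SignedPerm (n + 1)) :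
    prefixWeight s t m (flipFirst π) = prefixWeight s t m π := by
  have h1 : posWeight s t (flipFirst π) (-1) = posWeight s t π 1 := by
    simp [posWeight, val_flipFirst_neg_one, val_flipFirst_of_two_le]
  have h2 : posWeight s t (flipFirst π) 1 = posWeight s t π (-1) := by
    simp [posWeight, val_flipFirst_one, val_flipFirst_of_two_le]
  rw [prefixWeight_eq s t hm, prefixWeight_eq s t hm, h1, h2,
    mul_comm (posWeight s t π 1)]
  congr 1
  refine Finset.prod_congr rfl fun i hi => ?_
  rw [Finset.mem_Ico] at hi
  have hi2 : (2 : ℤ) ≤ i := by omega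
  apply posWeight_congr <;>
    rw [val_flipFirst_of_two_le π hi2, val_flipFirst_of_two_le π (by rw [abs_of_nonneg] <;> omega)]

/-- The generating function of the `prefixWeight`s by `inv_D` over all signed permutations. -/
noncomputable def prefixSum (s t q : K) (m n : ℕ) : K := ∑ π : SignedPerm n, prefixWeight s t m π * q ^ inv π

/-- The generating function of `inv_D` over all signed permutations. -/
noncomputable def invSum (q : K) (n : ℕ) : K := ∑ π : SignedPerm n, q ^ inv π

theorem invSum_succ_eq (q : K) (n : ℕ) :
    invSum q (n + 1) = (∑ x : Fin (n + 1) × ℤˣ, q ^ lastInv x) * invSum q n := by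
  simpa [invSum] using sum_extend q (n := n) (fun _ => 1) (fun _ => 1) fun _ _ _ => rfl

theorem prefixSum_mul_invSum (s t q : K) {m n : ℕ} (hm : 2 ≤ m) (hmn : m ≤ n) :
    prefixSum s t q m n * invSum q m = prefixSum s t q m m * invSum q n := by
  induction n, hmn using Nat.le_induction with
  | base => rfl
  | succ n hmn ih =>
    have h : prefixSum s t q m (n + 1) =
        (∑ x : Fin (n + 1) × ℤˣ, q ^ lastInv x) * prefixSum s t q m n :=
      sum_extend q _ _ (prefixWeight_extend s t hm hmn)
    rw [h, mul_assoc, ih, invSum_succ_eq]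
    ring

theorem invSum_eq_two_mul_poly (q : K) {n : ℕ} (hn : 1 ≤ n) : invSum q n = 2 * poly n 1 q := by
  obtain ⟨n, rfl⟩ := Nat.exists_eq_add_of_le' hn
  rw [invSum, sum_univ_eq_two_mul_sum_group _ fun π => by rw [inv_flipFirst], poly]
  simp

theorem prefixSum_self (s t q : K) {n : ℕ} (hn : 2 ≤ n) :
    prefixSum s t q n n = 2 * altPoly n s t q := by
  obtain ⟨k, rfl⟩ := Nat.exists_eq_add_of_le' (show 1 ≤ n by omega)
  rw [prefixSum, sum_univ_eq_two_mul_sum_group _ fun π => by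
    rw [inv_flipFirst, prefixWeight_flipFirst s t hn], altPoly]
  simp only [pow_odes_mul_pow_easc]

/-- The indicator of an ascent at the position `i`. -/
def ascInd (K : Type*) [Field K] {n : ℕ} (π : SignedPerm n) (i : ℤ) : K :=
  if π.val i < π.val (|i| + 1) then 1 else 0

open Classical in
theorem prod_ascInd {m k : ℕ} (π : SignedPerm (m + k)) :
    ∏ i ∈ Finset.Ico (m + 1) (m + k), ascInd K π i =
      if StrictMono (tailWord m π) then 1 else 0 := by
  cases k with
  | zero =>
    have h : StrictMono (tailWord m π) := fun i => i.elim0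
    simp [h]
  | succ k =>
    have hval : ∀ (j : Fin (k + 1)) (x : ℤ), x = m + (j : ℕ) + 1 → π.val x = tailWord m π j := by
      rintro j x rfl
      rw [tailWord, ← val_succ, Fin.val_natAdd, Nat.cast_add]
    have hlt : ∀ j : Fin k, (ascInd K π ((m + 1 + j : ℕ) : ℤ)) =
        if tailWord m π j.castSucc < tailWord m π j.succ then 1 else 0 := by
      intro j
      rw [ascInd, Nat.abs_cast, hval j.castSucc, hval j.succ]
      · rw [Fin.val_succ]; push_cast; ring
      · rw [Fin.val_castSucc]; push_cast; ring
    rw [Finset.prod_Ico_eq_prod_range, show m + (k + 1) - (m + 1) = k by omega,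
      ← Fin.prod_univ_eq_prod_range (fun i => ascInd K π ((m + 1 + i : ℕ) : ℤ)) k]
    simp only [hlt, Finset.prod_boole, Finset.mem_univ, true_imp_iff, Fin.strictMono_iff_lt_succ]

theorem sum_eq_qFact_mul_sum_ascInd (q : K) {m k : ℕ} (g : SignedPerm (m + k) → K)
    (hg : ∀ (τ : Equiv.Perm (Fin k)) π, g (rearrange (tailPerm m τ) π) = g π) :
    ∑ π, g π * q ^ inv π =
      qFact q k * ∑ π, g π * (∏ i ∈ Finset.Ico (m + 1) (m + k), ascInd K π i) * q ^ inv π := by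
  classical
  rw [sum_eq_qFact_mul_sum_strictMono q g hg]
  congr 1
  refine Finset.sum_congr rfl fun π _ => ?_
  rw [prod_ascInd]
  split_ifs <;> simp

theorem val_ne_val {n : ℕ} (π : SignedPerm n) {i j : ℤ} (hi : 1 ≤ i.natAbs) (hi' : i.natAbs ≤ n)
    (hj : 1 ≤ j.natAbs) (hj' : j.natAbs ≤ n) (hij : i.natAbs ≠ j.natAbs) :
    π.val i ≠ π.val j := by
  obtain ⟨u, k, rfl⟩ := exists_units_mul hi hi'
  obtain ⟨v, l, rfl⟩ := exists_units_mul hj hj'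
  rw [val_units_mul, val_units_mul]
  intro h
  have h2 := congrArg Int.natAbs h
  rw [Int.natAbs_mul, Int.natAbs_mul, Int.units_natAbs, Int.units_natAbs, one_mul, one_mul] at h2
  rw [natAbs_word_injective π h2, Int.natAbs_mul, Int.natAbs_mul, Int.units_natAbs,
    Int.units_natAbs] at hij
  exact hij rfl

/-- The weight of a position that is not required to be an ascent. -/
def freeWeight (t : K) (i : ℕ) : K := if Odd i then t else 1

/-- The additional weight of a position that is required to be an ascent. -/
def ascWeight (s t : K) (i : ℕ) : K := if Odd i then 1 - t else s - 1

theorem posWeight_eq_of_odd (s t : K) {n : ℕ} (π : SignedPerm n) {i : ℤ} (hodd : Odd i)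
    (h : π.val i ≠ π.val (|i| + 1)) : posWeight s t π i = t + (1 - t) * ascInd K π i := by
  rcases lt_or_gt_of_ne h with h | h
  · simp [posWeight, ascInd, hodd, h, h.not_gt]
  · simp [posWeight, ascInd, hodd, h, h.not_gt]

theorem posWeight_natCast (s t : K) {n : ℕ} (π : SignedPerm n) {i : ℕ} (hi : 1 ≤ i) (hin : i < n) :
    posWeight s t π i = freeWeight t i + ascWeight s t i * ascInd K π i := by
  by_cases hodd : Odd i
  · have hne : π.val (i : ℤ) ≠ π.val (|(i : ℤ)| + 1) := by
      rw [Nat.abs_cast]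
      exact val_ne_val π (by omega) (by omega) (by omega) (by omega) (by omega)
    rw [posWeight_eq_of_odd s t π (by exact_mod_cast hodd) hne]
    simp [freeWeight, ascWeight, hodd]
  · simp only [posWeight, freeWeight, ascWeight, ascInd, Int.odd_coe_nat, hodd, if_false]
    split_ifs <;> ring

theorem posWeight_neg_one (s t : K) {n : ℕ} (π : SignedPerm n) (hn : 2 ≤ n) :
    posWeight s t π (-1) = t + (1 - t) * ascInd K π (-1) :=
  posWeight_eq_of_odd s t π (by decide)
    (val_ne_val π (by decide) (by simp; omega) (by simp) (by simp; omega) (by simp))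

theorem prod_add_eq_sum_last_free (v b : ℕ → K) {n : ℕ} (hn : 2 ≤ n) :
    ∏ i ∈ Finset.Ico 2 n, (v i + b i) =
      ∑ m ∈ Finset.Ico 2 n, (∏ i ∈ Finset.Ico 2 m, (v i + b i)) * v m *
        ∏ i ∈ Finset.Ico (m + 1) n, b i + ∏ i ∈ Finset.Ico 2 n, b i := by
  induction n, hn using Nat.le_induction with
  | base => simp
  | succ n hn ih =>
    have hsum : ∑ m ∈ Finset.Ico 2 n, (∏ i ∈ Finset.Ico 2 m, (v i + b i)) * v m *
        ∏ i ∈ Finset.Ico (m + 1) (n + 1), b i = (∑ m ∈ Finset.Ico 2 n,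
          (∏ i ∈ Finset.Ico 2 m, (v i + b i)) * v m * ∏ i ∈ Finset.Ico (m + 1) n, b i) * b n := by
      rw [Finset.sum_mul]
      refine Finset.sum_congr rfl fun m hm => ?_
      rw [Finset.mem_Ico] at hm
      rw [Finset.prod_Ico_succ_top (by omega), mul_assoc, mul_assoc, mul_assoc]
    rw [Finset.prod_Ico_succ_top hn, Finset.sum_Ico_succ_top hn, hsum,
      Finset.prod_Ico_succ_top hn b, Finset.Ico_self, Finset.prod_empty]
    linear_combination (b n) * ih

end Weights

section Recursion

variable {K : Type*} [Field K]

/-- The signed permutation `1, 2, …, n`. -/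
def identity (n : ℕ) : SignedPerm n := (1, 1)

theorem word_identity (n : ℕ) (i : Fin n) : (identity n).word i = (i : ℕ) + 1 := by
  simp [identity, SignedPerm.word]

theorem inv_identity (n : ℕ) : inv (identity n) = 0 := by
  rw [inv_eq_wordInv, wordInv]
  refine Finset.sum_eq_zero fun i _ => Finset.sum_eq_zero fun j _ => ?_
  simp only [word_identity, invPair]
  split_ifs <;> omega

theorem eq_identity_or_flipFirst_identity {n : ℕ} {π : SignedPerm (n + 2)}
    (hmono : StrictMono π.word) (h : -π.word 0 < π.word 1) :
    π = identity (n + 2) ∨ π = flipFirst (identity (n + 2)) := by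
  have hone : ∀ j : Fin (n + 2), 0 < j → π.word 1 ≤ π.word j := by
    intro j hj
    refine hmono.monotone ?_
    rw [Fin.le_def]
    exact hj
  have habs : StrictMono fun i => (π.1 i : ℕ) := by
    intro i j hij
    have h1 := hone j (lt_of_le_of_lt (Fin.zero_le i) hij)
    have h2 : π.word 0 ≤ π.word i := hmono.monotone (Fin.zero_le i)
    have h3 := hmono hij
    have h4 := natAbs_word π i
    have h5 := natAbs_word π j
    change (π.1 i : ℕ) < π.1 j
    omega
  have hperm : π.1 = 1 := by
    have h1 : Monotone ((fun i : Fin (n + 2) => (i : ℕ)) ∘ π.1) := habs.monotone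
    have h2 : Monotone ((fun i : Fin (n + 2) => (i : ℕ)) ∘ (1 : Equiv.Perm (Fin (n + 2)))) :=
      fun _ _ hij => hij
    ext i
    exact congrFun (Tuple.unique_monotone h1 h2) i
  have hsign : ∀ j : Fin (n + 2), j ≠ 0 → π.2 j = 1 := by
    intro j hj
    have h0 : 0 < j := Fin.pos_iff_ne_zero.2 hj
    have h1 := hone j h0
    have h2 := hmono h0
    refine (Int.units_eq_one_or _).resolve_right fun hneg => ?_
    have h3 : π.word j = -((π.1 j : ℕ) + 1) := by simp [SignedPerm.word, hneg]
    omega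
  rcases Int.units_eq_one_or (π.2 0) with h0 | h0
  · left
    refine Prod.ext hperm (funext fun j => ?_)
    by_cases hj : j = 0
    · rw [hj, h0]; rfl
    · rw [hsign j hj]; rfl
  · right
    refine Prod.ext hperm (funext fun j => ?_)
    by_cases hj : j = 0
    · rw [hj, h0]; simp [flipFirst, identity]
    · rw [hsign j hj]; simp [flipFirst, identity, hj]

theorem val_two {n : ℕ} (π : SignedPerm (n + 2)) : π.val 2 = π.word 1 := by
  simpa using val_succ π 1

theorem ascInd_neg_one {n : ℕ} (π : SignedPerm (n + 2)) :
    ascInd K π (-1) = if -π.word 0 < π.word 1 then 1 else 0 := by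
  rw [ascInd, val_neg_one, show |(-1 : ℤ)| + 1 = 2 by decide, val_two]

open Classical in
theorem prod_ascInd_Ico_one {n : ℕ} (π : SignedPerm n) :
    ∏ i ∈ Finset.Ico 1 n, ascInd K π i = if StrictMono π.word then 1 else 0 := by
  have hcast : ∀ (n' : ℕ) (h : n = n') (π' : SignedPerm n'), π' = h ▸ π →
      (∏ i ∈ Finset.Ico 1 n', ascInd K π' i = if StrictMono π'.word then 1 else 0) →
      ∏ i ∈ Finset.Ico 1 n, ascInd K π i = if StrictMono π.word then 1 else 0 := by
    rintro _ rfl _ rfl h; exact h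
  refine hcast (0 + n) (Nat.zero_add n).symm _ rfl ?_
  generalize ((Nat.zero_add n).symm ▸ π : SignedPerm (0 + n)) = π'
  rw [← zero_add 1, prod_ascInd]
  refine if_congr ⟨fun h i j hij => ?_, fun h => h.comp (Fin.strictMono_natAdd 0)⟩ rfl rfl
  have := @h ⟨i, by omega⟩ ⟨j, by omega⟩ hij
  simpa [tailWord] using this

theorem sum_all_ascents (q : K) (n : ℕ) :
    ∑ π : SignedPerm (n + 2), ascInd K π (-1) * (∏ i ∈ Finset.Ico 1 (n + 2), ascInd K π i) *
      q ^ inv π = 2 := by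
  classical
  have hne : identity (n + 2) ≠ flipFirst (identity (n + 2)) := by
    intro h
    have h1 := congrArg (fun π => SignedPerm.word π 0) h
    simp only [word_flipFirst_zero, word_identity] at h1
    omega
  have hmono : StrictMono (identity (n + 2)).word := by
    intro i j hij
    have : (i : ℕ) < j := hij
    rw [word_identity, word_identity]
    omega
  have hmono' : StrictMono (flipFirst (identity (n + 2))).word := by
    rw [Fin.strictMono_iff_lt_succ]
    intro i
    refine Fin.cases ?_ (fun i => ?_) i
    · rw [Fin.castSucc_zero, word_flipFirst_zero, word_flipFirst_succ, word_identity, word_identity]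
      omega
    · rw [← Fin.succ_castSucc, word_flipFirst_succ, word_flipFirst_succ]
      exact hmono (by simp)
  have hpair : ∀ π : SignedPerm (n + 2), ascInd K π (-1) *
      (∏ i ∈ Finset.Ico 1 (n + 2), ascInd K π i) * q ^ inv π =
      if π ∈ ({identity (n + 2), flipFirst (identity (n + 2))} : Finset _) then 1 else 0 := by
    intro π
    rw [ascInd_neg_one, prod_ascInd_Ico_one]
    by_cases h : -π.word 0 < π.word 1 ∧ StrictMono π.word
    · rcases eq_identity_or_flipFirst_identity h.2 h.1 with rfl | rfl
      · rw [if_pos h.1, if_pos h.2, inv_identity]; simp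
      · rw [if_pos h.1, if_pos h.2, inv_flipFirst, inv_identity]; simp
    · rw [if_neg (c := π ∈ _)]
      · rcases not_and_or.1 h with h | h <;> simp [h]
      · rw [Finset.mem_insert, Finset.mem_singleton]
        rintro (rfl | rfl)
        · refine h ⟨?_, hmono⟩
          rw [word_identity, word_identity]; omega
        · refine h ⟨?_, hmono'⟩
          rw [← Fin.succ_zero_eq_one, word_flipFirst_zero, word_flipFirst_succ, word_identity,
            word_identity]
          simp
  rw [Finset.sum_congr rfl fun π _ => hpair π, ← Finset.sum_filter, Finset.sum_const,
    Finset.filter_mem_eq_inter, Finset.univ_inter, Finset.card_pair hne]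
  simp

theorem ascInd_flipFirst_one {n : ℕ} (π : SignedPerm (n + 2)) :
    ascInd K (flipFirst π) 1 = ascInd K π (-1) := by
  simp [ascInd, val_flipFirst_one, val_flipFirst_of_two_le]

theorem ascInd_flipFirst_of_two_le {n : ℕ} (π : SignedPerm (n + 2)) {i : ℤ} (hi : 2 ≤ i) :
    ascInd K (flipFirst π) i = ascInd K π i := by
  rw [ascInd, ascInd, abs_of_nonneg (by omega), val_flipFirst_of_two_le π hi,
    val_flipFirst_of_two_le π (by omega)]

theorem sum_ascents_neg_one (q : K) (n : ℕ) :
    ∑ π : SignedPerm (n + 2), ascInd K π (-1) * (∏ i ∈ Finset.Ico 2 (n + 2), ascInd K π i) *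
      q ^ inv π =
    ∑ π : SignedPerm (n + 2), (∏ i ∈ Finset.Ico 1 (n + 2), ascInd K π i) * q ^ inv π := by
  symm
  rw [← Equiv.sum_comp (flipFirstEquiv (n + 1))]
  refine Finset.sum_congr rfl fun π _ => ?_
  change (∏ i ∈ Finset.Ico 1 (n + 2), ascInd K (flipFirst π) i) * q ^ inv (flipFirst π) = _
  rw [inv_flipFirst, Finset.prod_eq_prod_Ico_succ_bot (by omega), Nat.cast_one,
    ascInd_flipFirst_one]
  congr 2
  refine Finset.prod_congr rfl fun i hi => ascInd_flipFirst_of_two_le π ?_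
  rw [Finset.mem_Ico] at hi
  omega

theorem qFact_mul_sum_ascents (q : K) {m n : ℕ} (hmn : m ≤ n) :
    qFact q (n - m) * ∑ π : SignedPerm n, (∏ i ∈ Finset.Ico (m + 1) n, ascInd K π i) * q ^ inv π =
      invSum q n := by
  obtain ⟨k, rfl⟩ := Nat.exists_eq_add_of_le hmn
  rw [Nat.add_sub_cancel_left]
  simpa [invSum] using (sum_eq_qFact_mul_sum_ascInd q (m := m) (k := k) (fun _ => 1)
    fun _ _ => rfl).symm

theorem qFact_mul_sum_prefixWeight (s t q : K) {m n : ℕ} (hm : 2 ≤ m) (hmn : m ≤ n) :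
    qFact q (n - m) * ∑ π : SignedPerm n, prefixWeight s t m π *
      (∏ i ∈ Finset.Ico (m + 1) n, ascInd K π i) * q ^ inv π = prefixSum s t q m n := by
  obtain ⟨k, rfl⟩ := Nat.exists_eq_add_of_le hmn
  rw [Nat.add_sub_cancel_left]
  exact (sum_eq_qFact_mul_sum_ascInd q (prefixWeight s t m) (prefixWeight_rearrange s t hm)).symm

theorem prefixWeight_eq_sum (s t : K) {n : ℕ} (hn : 2 ≤ n) (π : SignedPerm n) :
    prefixWeight s t n π =
      ∑ m ∈ Finset.Ico 2 n, freeWeight t m * (∏ i ∈ Finset.Ico (m + 1) n, ascWeight s t i) *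
        (prefixWeight s t m π * ∏ i ∈ Finset.Ico (m + 1) n, ascInd K π i) +
      (∏ i ∈ Finset.Ico 2 n, ascWeight s t i) *
        (t ^ 2 * ∏ i ∈ Finset.Ico 2 n, ascInd K π i +
          t * (1 - t) * ∏ i ∈ Finset.Ico 1 n, ascInd K π i +
          t * (1 - t) * (ascInd K π (-1) * ∏ i ∈ Finset.Ico 2 n, ascInd K π i) +
          (1 - t) ^ 2 * (ascInd K π (-1) * ∏ i ∈ Finset.Ico 1 n, ascInd K π i)) := by
  have hpos : ∀ m ≤ n, ∏ i ∈ Finset.Ico 2 m, posWeight s t π i =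
      ∏ i ∈ Finset.Ico 2 m, (freeWeight t i + ascWeight s t i * ascInd K π i) := by
    intro m hm
    refine Finset.prod_congr rfl fun i hi => ?_
    rw [Finset.mem_Ico] at hi
    exact posWeight_natCast s t π (by omega) (by omega)
  have h1 : posWeight s t π 1 = t + (1 - t) * ascInd K π 1 := by
    simpa [freeWeight, ascWeight] using posWeight_natCast s t π (i := 1) le_rfl (by omega)
  have hsum : ∑ m ∈ Finset.Ico 2 n, freeWeight t m *
      (∏ i ∈ Finset.Ico (m + 1) n, ascWeight s t i) *
        (prefixWeight s t m π * ∏ i ∈ Finset.Ico (m + 1) n, ascInd K π i) =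
      posWeight s t π (-1) * posWeight s t π 1 * ∑ m ∈ Finset.Ico 2 n,
        (∏ i ∈ Finset.Ico 2 m, (freeWeight t i + ascWeight s t i * ascInd K π i)) *
          freeWeight t m * ∏ i ∈ Finset.Ico (m + 1) n, (ascWeight s t i * ascInd K π i) := by
    rw [Finset.mul_sum]
    refine Finset.sum_congr rfl fun m hm => ?_
    rw [Finset.mem_Ico] at hm
    rw [prefixWeight_eq s t hm.1, hpos m hm.2.le, Finset.prod_mul_distrib]
    ring
  rw [hsum, prefixWeight_eq s t hn, hpos n le_rfl, prod_add_eq_sum_last_free _ _ hn,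
    posWeight_neg_one s t π hn, h1, Finset.prod_eq_prod_Ico_succ_bot (show 1 < n by omega)
      fun i : ℕ => ascInd K π i, Finset.prod_mul_distrib, Nat.cast_one]
  ring

/-- Splitting off the last maximal run of positions required to be ascents. -/
theorem altPoly_div_poly_eq [CharZero K] (s t q : K) (hq : ∀ n : ℕ, qFact q n ≠ 0)
    (hD : ∀ n : ℕ, poly n 1 q ≠ 0) {n : ℕ} (hn : 2 ≤ n) :
    altPoly n s t q / poly n 1 q =
      (∏ i ∈ Finset.Ico 2 n, ascWeight s t i) *
        (t ^ 2 / qFact q (n - 1) + 2 * t * (1 - t) / qFact q n + (1 - t) ^ 2 / poly n 1 q) +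
      ∑ m ∈ Finset.Ico 2 n, freeWeight t m * (∏ i ∈ Finset.Ico (m + 1) n, ascWeight s t i) *
        (altPoly m s t q / poly m 1 q) / qFact q (n - m) := by
  have hB : ∀ m, 1 ≤ m → invSum q m ≠ 0 := fun m hm => by
    rw [invSum_eq_two_mul_poly q hm]; exact mul_ne_zero two_ne_zero (hD m)
  have hratio : ∀ m, 2 ≤ m → altPoly m s t q / poly m 1 q = prefixSum s t q m m / invSum q m := by
    intro m hm
    rw [prefixSum_self s t q hm, invSum_eq_two_mul_poly q (by omega),
      mul_div_mul_left _ _ two_ne_zero]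
  have hS1 := qFact_mul_sum_ascents q (m := 1) (n := n) (by omega)
  have hS0 := qFact_mul_sum_ascents q (m := 0) (n := n) (by omega)
  have hneg : ∑ π : SignedPerm n, ascInd K π (-1) * (∏ i ∈ Finset.Ico 2 n, ascInd K π i) *
      q ^ inv π = invSum q n / qFact q n := by
    rw [← hS0, Nat.sub_zero, mul_div_cancel_left₀ _ (hq n)]
    obtain ⟨k, rfl⟩ := Nat.exists_eq_add_of_le' hn
    exact sum_ascents_neg_one q k
  have hall : ∑ π : SignedPerm n, ascInd K π (-1) * (∏ i ∈ Finset.Ico 1 n, ascInd K π i) *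
      q ^ inv π = 2 := by
    obtain ⟨k, rfl⟩ := Nat.exists_eq_add_of_le' hn
    exact sum_all_ascents q k
  have hS1' := eq_div_of_mul_eq (hq _) ((mul_comm _ _).trans hS1)
  have hS0' := eq_div_of_mul_eq (hq _) ((mul_comm _ _).trans hS0)
  have hSm : ∀ m ∈ Finset.Ico 2 n, ∑ π : SignedPerm n, prefixWeight s t m π *
      (∏ i ∈ Finset.Ico (m + 1) n, ascInd K π i) * q ^ inv π =
      invSum q n * (altPoly m s t q / poly m 1 q) / qFact q (n - m) := by
    intro m hm
    rw [Finset.mem_Ico] at hm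
    rw [eq_div_of_mul_eq (hq _) ((mul_comm _ _).trans
      (qFact_mul_sum_prefixWeight s t q hm.1 hm.2.le)), hratio m hm.1]
    congr 1
    have := prefixSum_mul_invSum s t q hm.1 hm.2.le
    have hBm := hB m (by omega)
    field_simp
    linear_combination this
  have hexpand : prefixSum s t q n n =
      ∑ m ∈ Finset.Ico 2 n, freeWeight t m * (∏ i ∈ Finset.Ico (m + 1) n, ascWeight s t i) *
        (invSum q n * (altPoly m s t q / poly m 1 q) / qFact q (n - m)) +
      (∏ i ∈ Finset.Ico 2 n, ascWeight s t i) *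
        (t ^ 2 * (invSum q n / qFact q (n - 1)) + t * (1 - t) * (invSum q n / qFact q n) +
          t * (1 - t) * (invSum q n / qFact q n) + (1 - t) ^ 2 * 2) := by
    rw [Nat.sub_zero] at hS0'
    rw [← hS1']
    nth_rewrite 2 [← hneg]
    rw [← hS0', ← hall, ← Finset.sum_congr rfl fun m hm => by rw [← hSm m hm]]
    simp only [Finset.mul_sum]
    rw [Finset.sum_comm]
    simp only [← Finset.sum_add_distrib, Finset.mul_sum, prefixSum]
    refine Finset.sum_congr rfl fun π _ => ?_
    rw [prefixWeight_eq_sum s t hn π, add_mul, Finset.sum_mul]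
    congr 1
    · exact Finset.sum_congr rfl fun m _ => by ring
    · ring
  rw [hratio n hn, hexpand, add_div, add_comm]
  have hBn := hB n (by omega)
  congr 1
  · rw [invSum_eq_two_mul_poly q (by omega)]
    have h1 := hD n
    have h2 := hq n
    have h3 := hq (n - 1)
    field_simp
    ring
  · rw [Finset.sum_div]
    refine Finset.sum_congr rfl fun m _ => ?_
    field_simp

end Recursion

section Series

variable {K : Type*} [Field K]

theorem coeff_rescale_cosOf [CharZero K] {ι : K} (hι : ι ^ 2 = -1) (M : K) (f : K⟦X⟧) (n : ℕ) :
    coeff n (rescale M (cosOf ι f)) =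
      if Even n then (-M ^ 2) ^ (n / 2) * coeff n f else 0 := by
  rw [coeff_rescale, cosOf, coeff_C_mul, map_add, coeff_rescale, coeff_rescale]
  split_ifs with h
  · obtain ⟨a, rfl⟩ := h
    rw [show (a + a) / 2 = a by omega, ← two_mul, pow_mul, pow_mul, pow_mul, neg_sq, hι,
      neg_pow (M ^ 2)]
    ring
  · rw [Nat.not_even_iff_odd] at h
    rw [h.neg_pow]
    ring

theorem coeff_rescale_sinOf [CharZero K] {ι : K} (hι : ι ^ 2 = -1) (M : K) (f : K⟦X⟧) (n : ℕ) :
    coeff n (rescale M (sinOf ι f)) =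
      if Odd n then M * (-M ^ 2) ^ (n / 2) * coeff n f else 0 := by
  have hι0 : ι ≠ 0 := by
    rintro rfl
    simp at hι
  rw [coeff_rescale, sinOf, coeff_C_mul, map_sub, coeff_rescale, coeff_rescale]
  split_ifs with h
  · rw [h.neg_pow]
    obtain ⟨a, rfl⟩ := h
    rw [show (2 * a + 1) / 2 = a by omega, pow_succ, pow_succ, pow_mul, pow_mul, hι,
      neg_pow (M ^ 2)]
    field_simp
    ring
  · rw [Nat.not_odd_iff_even] at h
    rw [h.neg_pow]
    ring

theorem rescale_expQ_mul_rescale_expQ [CharZero K] {ι : K} (hι : ι ^ 2 = -1) (M q : K) :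
    rescale (ι * M) (expQ q) * rescale (-(ι * M)) (expQ q) =
      rescale M (cosQ ι q) ^ 2 + rescale M (sinQ ι q) ^ 2 := by
  have hι0 : ι ≠ 0 := by
    rintro rfl
    simp at hι
  have hC : ∀ a b : K, rescale a (C b) = C b := by
    intro a b
    ext n
    rw [coeff_rescale, coeff_C]
    split_ifs with h <;> simp [h]
  have h2 : (C (2 : K) : K⟦X⟧) = 2 := map_ofNat C 2
  have hcos : 2 * rescale M (cosQ ι q) =
      rescale (ι * M) (expQ q) + rescale (-(ι * M)) (expQ q) := by
    rw [cosQ, cosOf, map_mul, map_add, hC, rescale_rescale, rescale_rescale, neg_mul, ← h2,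
      ← mul_assoc, ← map_mul, mul_one_div_cancel two_ne_zero, map_one, one_mul]
  have hsin : 2 * C ι * rescale M (sinQ ι q) =
      rescale (ι * M) (expQ q) - rescale (-(ι * M)) (expQ q) := by
    rw [sinQ, sinOf, map_mul, map_sub, hC, rescale_rescale, rescale_rescale, neg_mul, ← h2,
      ← mul_assoc, ← map_mul, ← map_mul, mul_one_div_cancel (mul_ne_zero two_ne_zero hι0),
      map_one, one_mul]
  have hsq : (C ι : K⟦X⟧) ^ 2 = -1 := by rw [← map_pow, hι, map_neg, map_one]
  have h4 : (4 : K⟦X⟧) ≠ 0 := by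
    rw [show (4 : K⟦X⟧) = C 4 from (map_ofNat C 4).symm]
    simp
  refine mul_left_cancel₀ h4 ?_
  linear_combination (rescale (ι * M) (expQ q) + rescale (-(ι * M)) (expQ q) +
    2 * rescale M (cosQ ι q)) * (-hcos) + (rescale (ι * M) (expQ q) -
      rescale (-(ι * M)) (expQ q) + 2 * C ι * rescale M (sinQ ι q)) * hsin -
    4 * rescale M (sinQ ι q) ^ 2 * hsq

theorem prod_ascWeight_odd (s t : K) (m a : ℕ) :
    ∏ i ∈ Finset.Ico (m + 1) (m + (2 * a + 1)), ascWeight s t i = ((s - 1) * (1 - t)) ^ a := by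
  induction a with
  | zero => simp
  | succ a ih =>
    rw [show m + (2 * (a + 1) + 1) = m + (2 * a + 1) + 1 + 1 by ring,
      Finset.prod_Ico_succ_top (by omega), Finset.prod_Ico_succ_top (by omega), ih, pow_succ,
      mul_assoc]
    congr 1
    simp only [ascWeight, Nat.odd_add_one (n := m + (2 * a + 1))]
    split_ifs
    · exact mul_comm _ _
    · rfl

theorem prod_ascWeight_even (s t : K) (m a : ℕ) :
    ∏ i ∈ Finset.Ico (m + 1) (m + (2 * a + 2)), ascWeight s t i =
      ((s - 1) * (1 - t)) ^ a * ascWeight s t (m + 1) := by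
  rw [← add_assoc m (2 * a + 1) 1, Finset.prod_Ico_succ_top (by omega), prod_ascWeight_odd]
  congr 1
  have : Odd (m + (2 * a + 1)) ↔ Odd (m + 1) := by grind
  simp only [ascWeight, this]

theorem coeff_mul_eq_sum_Ico {A B : K⟦X⟧} (hA : ∀ m < 2, coeff m A = 0) (hB : coeff 0 B = 0)
    (n : ℕ) : coeff n (A * B) = ∑ m ∈ Finset.Ico 2 n, coeff m A * coeff (n - m) B := by
  rw [coeff_mul, Finset.Nat.sum_antidiagonal_eq_sum_range_succ_mk]
  symm
  refine Finset.sum_subset (fun m hm => ?_) fun m hm hm' => ?_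
  · rw [Finset.mem_Ico] at hm
    rw [Finset.mem_range]
    omega
  · rw [Finset.mem_range] at hm
    rw [Finset.mem_Ico] at hm'
    rcases lt_or_ge m 2 with h | h
    · rw [hA m h, zero_mul]
    · rw [show n - m = 0 by omega, hB, mul_zero]

theorem coeff_altEgfEven_of_even (s t q : K) {m : ℕ} (hm : Even m) (hm2 : 2 ≤ m) :
    coeff m (altEgfEven s t q) = altPoly m s t q / poly m 1 q := by
  rw [altEgfEven, coeff_mk, if_pos ⟨hm, hm2⟩]

theorem coeff_altEgfEven_of_odd (s t q : K) {m : ℕ} (hm : Odd m) :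
    coeff m (altEgfEven s t q) = 0 := by
  rw [altEgfEven, coeff_mk, if_neg fun h => (Nat.not_even_iff_odd.2 hm) h.1]

theorem coeff_altEgfOdd_of_odd (s t q : K) {m : ℕ} (hm : Odd m) (hm2 : 2 ≤ m) :
    coeff m (altEgfOdd s t q) = altPoly m s t q / poly m 1 q := by
  have : m ≠ 2 := by rintro rfl; exact absurd hm (by decide)
  rw [altEgfOdd, coeff_mk, if_pos ⟨hm, by omega⟩]

theorem coeff_altEgfOdd_of_even (s t q : K) {m : ℕ} (hm : Even m) :
    coeff m (altEgfOdd s t q) = 0 := by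
  rw [altEgfOdd, coeff_mk, if_neg fun h => (Nat.not_odd_iff_even.2 hm) h.1]

theorem coeff_altEgfEven_of_lt (s t q : K) {m : ℕ} (hm : m < 2) :
    coeff m (altEgfEven s t q) = 0 := by
  rw [altEgfEven, coeff_mk, if_neg (by omega)]

theorem coeff_altEgfOdd_of_lt (s t q : K) {m : ℕ} (hm : m < 2) :
    coeff m (altEgfOdd s t q) = 0 := by
  rw [altEgfOdd, coeff_mk, if_neg (by omega)]

theorem poly_one (q : K) : poly 1 1 q = 1 := by
  have h1 : group 1 = {identity 1} := by decide
  rw [poly, h1, Finset.sum_singleton, inv_identity]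
  simp

theorem poly_zero (q : K) : poly 0 1 q = 1 := by
  have h1 : group 0 = {identity 0} := by decide
  rw [poly, h1, Finset.sum_singleton, inv_identity]
  simp

section System

variable [CharZero K] {s t q M r ι : K}

theorem coeff_cosQ_even (hι : ι ^ 2 = -1) (hM : M ^ 2 = (1 - s) * (1 - t)) (a : ℕ) :
    coeff (2 * a) (rescale M (cosQ ι q)) = ((s - 1) * (1 - t)) ^ a / qFact q (2 * a) := by
  rw [cosQ, coeff_rescale_cosOf hι, if_pos (even_two_mul a), hM, expQ, coeff_mk,
    Nat.mul_div_cancel_left a two_pos]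
  ring

theorem coeff_cosQ_odd (hι : ι ^ 2 = -1) {n : ℕ} (hn : Odd n) :
    coeff n (rescale M (cosQ ι q)) = 0 := by
  rw [cosQ, coeff_rescale_cosOf hι, if_neg (Nat.not_even_iff_odd.2 hn)]

theorem coeff_cosD_even (hι : ι ^ 2 = -1) (hM : M ^ 2 = (1 - s) * (1 - t)) (a : ℕ) :
    coeff (2 * a) (rescale M (cosD ι q)) = ((s - 1) * (1 - t)) ^ a / poly (2 * a) 1 q := by
  rw [cosD, coeff_rescale_cosOf hι, if_pos (even_two_mul a), hM, expD, coeff_mk,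
    Nat.mul_div_cancel_left a two_pos]
  ring

theorem coeff_cosD_odd (hι : ι ^ 2 = -1) {n : ℕ} (hn : Odd n) :
    coeff n (rescale M (cosD ι q)) = 0 := by
  rw [cosD, coeff_rescale_cosOf hι, if_neg (Nat.not_even_iff_odd.2 hn)]

theorem coeff_sinQ_odd (hι : ι ^ 2 = -1) (hM : M ^ 2 = (1 - s) * (1 - t)) (a : ℕ) :
    coeff (2 * a + 1) (rescale M (sinQ ι q)) =
      M * ((s - 1) * (1 - t)) ^ a / qFact q (2 * a + 1) := by
  rw [sinQ, coeff_rescale_sinOf hι, if_pos (odd_two_mul_add_one a), hM, expQ, coeff_mk,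
    show (2 * a + 1) / 2 = a by omega]
  ring

theorem coeff_sinQ_even (hι : ι ^ 2 = -1) {n : ℕ} (hn : Even n) :
    coeff n (rescale M (sinQ ι q)) = 0 := by
  rw [sinQ, coeff_rescale_sinOf hι, if_neg (Nat.not_odd_iff_even.2 hn)]

theorem coeff_sinD_odd (hι : ι ^ 2 = -1) (hM : M ^ 2 = (1 - s) * (1 - t)) (a : ℕ) :
    coeff (2 * a + 1) (rescale M (sinD ι q)) =
      M * ((s - 1) * (1 - t)) ^ a / poly (2 * a + 1) 1 q := by
  rw [sinD, coeff_rescale_sinOf hι, if_pos (odd_two_mul_add_one a), hM, expD, coeff_mk,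
    show (2 * a + 1) / 2 = a by omega]
  ring

theorem coeff_sinD_even (hι : ι ^ 2 = -1) {n : ℕ} (hn : Even n) :
    coeff n (rescale M (sinD ι q)) = 0 := by
  rw [sinD, coeff_rescale_sinOf hι, if_neg (Nat.not_odd_iff_even.2 hn)]

theorem coeff_transED_even (hι : ι ^ 2 = -1) (hM : M ^ 2 = (1 - s) * (1 - t)) (hM0 : M ≠ 0)
    (a : ℕ) : coeff (2 * (a + 1)) (transED ι M s t q) =
      (s - 1) * (((s - 1) * (1 - t)) ^ a * (t ^ 2 / qFact q (2 * a + 1) +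
        2 * t * (1 - t) / qFact q (2 * (a + 1)) + (1 - t) ^ 2 / poly (2 * (a + 1)) 1 q)) := by
  have h1 : coeff (2 * (a + 1)) (1 : K⟦X⟧) = 0 := by rw [coeff_one, if_neg (by omega)]
  have h2 : coeff (2 * (a + 1)) (X * rescale M (sinQ ι q)) =
      M * ((s - 1) * (1 - t)) ^ a / qFact q (2 * a + 1) := by
    rw [show 2 * (a + 1) = (2 * a + 1) + 1 by ring, coeff_succ_X_mul, coeff_sinQ_odd hι hM]
  rw [transED, map_add, map_add, mul_assoc, coeff_C_mul, coeff_C_mul, coeff_C_mul, map_sub,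
    map_sub, h1, h2, coeff_cosQ_even hι hM, coeff_cosD_even hι hM, pow_succ]
  field_simp
  ring

theorem coeff_transED_odd (hι : ι ^ 2 = -1) {n : ℕ} (hn : Odd n) :
    coeff n (transED ι M s t q) = 0 := by
  obtain ⟨a, rfl⟩ := hn
  have h1 : coeff (2 * a + 1) (1 : K⟦X⟧) = 0 := by rw [coeff_one, if_neg (by omega)]
  rw [transED, map_add, map_add, mul_assoc, coeff_C_mul, coeff_C_mul, coeff_C_mul, map_sub,
    map_sub, h1, coeff_succ_X_mul, coeff_sinQ_even hι (even_two_mul a),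
    coeff_cosQ_odd hι (odd_two_mul_add_one a), coeff_cosD_odd hι (odd_two_mul_add_one a)]
  ring

theorem coeff_zero_transED (hι : ι ^ 2 = -1) (hM : M ^ 2 = (1 - s) * (1 - t)) :
    coeff 0 (transED ι M s t q) = 0 := by
  have h1 := coeff_cosQ_even (q := q) hι hM 0
  have h2 := coeff_cosD_even (q := q) hι hM 0
  rw [mul_zero, pow_zero] at h1 h2
  rw [transED, map_add, map_add, mul_assoc, coeff_C_mul, coeff_C_mul, coeff_C_mul, map_sub,
    map_sub, coeff_zero_X_mul, h1, h2, poly_zero]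
  simp [qFact]

end System

end Series

section System

variable {K : Type*} [Field K] [CharZero K] {s t q M r ι : K}

theorem coeff_transOD_odd (hι : ι ^ 2 = -1) (hM : M ^ 2 = (1 - s) * (1 - t)) (hM0 : M ≠ 0)
    (hs1 : s ≠ 1) (a : ℕ) : coeff (2 * (a + 1) + 1) (transOD ι M r s t q) =
      r * ((1 - t) * (((s - 1) * (1 - t)) ^ a * (s - 1) * (t ^ 2 / qFact q (2 * (a + 1)) +
        2 * t * (1 - t) / qFact q (2 * (a + 1) + 1) +
        (1 - t) ^ 2 / poly (2 * (a + 1) + 1) 1 q))) := by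
  have h1 : coeff (2 * (a + 1) + 1) (X * (rescale M (cosQ ι q) - 1)) =
      ((s - 1) * (1 - t)) ^ (a + 1) / qFact q (2 * (a + 1)) := by
    rw [coeff_succ_X_mul, map_sub, coeff_cosQ_even hι hM, coeff_one, if_neg (by omega), sub_zero]
  have h2 : coeff (2 * (a + 1) + 1) (C M * X) = 0 := by
    rw [coeff_C_mul, coeff_X, if_neg (by omega), mul_zero]
  have hs : s - 1 ≠ 0 := sub_ne_zero.2 hs1
  rw [transOD, map_add, map_sub, mul_assoc, coeff_C_mul, coeff_C_mul, coeff_C_mul, map_sub,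
    map_sub, h1, h2, coeff_sinQ_odd hι hM, coeff_sinD_odd hι hM, pow_succ _ a]
  have hMs : (1 - t) * M * r / (s - 1) * (M * (((s - 1) * (1 - t)) ^ a * ((s - 1) * (1 - t))) /
      poly (2 * (a + 1) + 1) 1 q - 0) =
      -(r * (1 - t) ^ 3 * (s - 1) * ((s - 1) * (1 - t)) ^ a / poly (2 * (a + 1) + 1) 1 q) := by
    have : (1 - t) * M * r / (s - 1) * (M * (((s - 1) * (1 - t)) ^ a * ((s - 1) * (1 - t))) /
      poly (2 * (a + 1) + 1) 1 q - 0) = M ^ 2 * ((1 - t) * r * (((s - 1) * (1 - t)) ^ a *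
        (1 - t)) * ((s - 1) / (s - 1)) / poly (2 * (a + 1) + 1) 1 q) := by ring
    rw [this, hM, div_self hs]
    ring
  rw [hMs]
  field_simp
  ring

theorem coeff_transOD_even (hι : ι ^ 2 = -1) {n : ℕ} (hn : Even n) :
    coeff n (transOD ι M r s t q) = 0 := by
  have h1 : coeff n (X * (rescale M (cosQ ι q) - 1)) = 0 := by
    rcases n with _ | n
    · exact coeff_zero_X_mul _
    · have hodd : Odd n := by
        rw [← Nat.not_even_iff_odd]
        exact fun h => (Nat.not_even_iff_odd.2 h.add_one) hn
      have : n ≠ 0 := by rintro rfl; exact absurd hodd (by decide)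
      rw [coeff_succ_X_mul, map_sub, coeff_cosQ_odd hι hodd, coeff_one, if_neg this, sub_zero]
  have h2 : coeff n (C M * X) = 0 := by
    have : n ≠ 1 := by rintro rfl; exact absurd hn (by decide)
    rw [coeff_C_mul, coeff_X, if_neg this, mul_zero]
  rw [transOD, map_add, map_sub, mul_assoc, coeff_C_mul, coeff_C_mul, coeff_C_mul, map_sub,
    map_sub, h1, h2, coeff_sinQ_even hι hn, coeff_sinD_even hι hn]
  ring

theorem coeff_one_transOD (hι : ι ^ 2 = -1) (hM : M ^ 2 = (1 - s) * (1 - t)) :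
    coeff 1 (transOD ι M r s t q) = 0 := by
  have h1 := coeff_cosQ_even (q := q) hι hM 0
  have h2 := coeff_sinQ_odd (q := q) hι hM 0
  have h3 := coeff_sinD_odd (q := q) hι hM 0
  rw [mul_zero, pow_zero] at h1
  rw [mul_zero, zero_add, pow_zero] at h2 h3
  have h4 : coeff 1 (X * (rescale M (cosQ ι q) - 1)) = 0 := by
    rw [show 1 = 0 + 1 from rfl, coeff_succ_X_mul, map_sub, h1]
    simp [qFact]
  have h5 : coeff 1 (C M * X) = M := by rw [coeff_C_mul, coeff_X, if_pos rfl, mul_one]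
  rw [transOD, map_add, map_sub, mul_assoc, coeff_C_mul, coeff_C_mul, coeff_C_mul, map_sub,
    map_sub, h2, h3, h4, h5, poly_one]
  simp [qFact, qNat]

theorem coeff_cosQ_sub_one (hι : ι ^ 2 = -1) (hM : M ^ 2 = (1 - s) * (1 - t)) (a : ℕ) :
    coeff (2 * a + 2) (rescale M (cosQ ι q) - 1) =
      ((s - 1) * (1 - t)) ^ a * ((s - 1) * (1 - t)) / qFact q (2 * a + 2) := by
  have := coeff_cosQ_even (q := q) hι hM (a + 1)
  rw [show 2 * (a + 1) = 2 * a + 2 by ring] at this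
  rw [map_sub, this, coeff_one, if_neg (by omega), sub_zero, pow_succ]

theorem coeff_zero_cosQ_sub_one (hι : ι ^ 2 = -1) (hM : M ^ 2 = (1 - s) * (1 - t)) :
    coeff 0 (rescale M (cosQ ι q) - 1) = 0 := by
  have h1 := coeff_cosQ_even (q := q) hι hM 0
  rw [mul_zero, pow_zero] at h1
  rw [map_sub, h1]
  simp [qFact]

theorem coeff_cosQ_sub_one_odd (hι : ι ^ 2 = -1) {n : ℕ} (hn : Odd n) :
    coeff n (rescale M (cosQ ι q) - 1) = 0 := by
  have : n ≠ 0 := by rintro rfl; exact absurd hn (by decide)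
  rw [map_sub, coeff_cosQ_odd hι hn, coeff_one, if_neg this, sub_zero]

theorem altEgfEven_system (hι : ι ^ 2 = -1) (hM : M ^ 2 = (1 - s) * (1 - t)) (hM0 : M ≠ 0)
    (hq : ∀ n : ℕ, qFact q n ≠ 0) (hD : ∀ n : ℕ, poly n 1 q ≠ 0) :
    C (s - 1) * altEgfEven s t q = transED ι M s t q +
      altEgfEven s t q * (rescale M (cosQ ι q) - 1) +
      C (t * (s - 1) / M) * (altEgfOdd s t q * rescale M (sinQ ι q)) := by
  have hE : ∀ m < 2, coeff m (altEgfEven s t q) = 0 := fun m hm => coeff_altEgfEven_of_lt s t q hm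
  have hO : ∀ m < 2, coeff m (altEgfOdd s t q) = 0 := fun m hm => coeff_altEgfOdd_of_lt s t q hm
  ext n
  rw [map_add, map_add, coeff_C_mul, coeff_C_mul,
    coeff_mul_eq_sum_Ico hE (coeff_zero_cosQ_sub_one hι hM),
    coeff_mul_eq_sum_Ico hO (coeff_sinQ_even hι Even.zero)]
  rcases Nat.even_or_odd n with hn | hn
  · rcases Nat.eq_zero_or_pos n with rfl | hpos
    · rw [coeff_zero_transED hι hM, hE 0 two_pos]
      simp
    · obtain ⟨a, rfl⟩ : ∃ a, n = 2 * (a + 1) := by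
        obtain ⟨b, rfl⟩ := hn
        exact ⟨b - 1, by omega⟩
      have hW := prod_ascWeight_odd s t 1 a
      rw [show 1 + (2 * a + 1) = 2 * (a + 1) by ring] at hW
      rw [coeff_transED_even hι hM hM0, coeff_altEgfEven_of_even s t q hn (by omega),
        altPoly_div_poly_eq s t q hq hD (by omega), hW, mul_add (s - 1),
        add_assoc ((s - 1) * _)]
      congr 1
      rw [Finset.mul_sum, Finset.mul_sum, ← Finset.sum_add_distrib]
      refine Finset.sum_congr rfl fun m hm => ?_
      rw [Finset.mem_Ico] at hm
      rcases Nat.even_or_odd m with hm' | hm'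
      · obtain ⟨b, hb⟩ : ∃ b, 2 * (a + 1) = m + (2 * b + 2) := by
          obtain ⟨c, rfl⟩ := hm'
          exact ⟨a - c, by omega⟩
        have hw : ascWeight s t (m + 1) = 1 - t := by rw [ascWeight, if_pos hm'.add_one]
        rw [hb, prod_ascWeight_even, Nat.add_sub_cancel_left, coeff_cosQ_sub_one hι hM, hw,
          coeff_altEgfEven_of_even s t q hm' hm.1, coeff_altEgfOdd_of_even s t q hm', freeWeight,
          if_neg (Nat.not_odd_iff_even.2 hm')]
        ring
      · obtain ⟨b, hb⟩ : ∃ b, 2 * (a + 1) = m + (2 * b + 1) := by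
          obtain ⟨c, rfl⟩ := hm'
          exact ⟨a - c, by omega⟩
        rw [hb, prod_ascWeight_odd, Nat.add_sub_cancel_left, coeff_sinQ_odd hι hM,
          coeff_altEgfOdd_of_odd s t q hm' hm.1, coeff_altEgfEven_of_odd s t q hm', freeWeight,
          if_pos hm']
        field_simp
        ring
  · have h1 : ∀ m ∈ Finset.Ico 2 n, coeff m (altEgfEven s t q) *
        coeff (n - m) (rescale M (cosQ ι q) - 1) = 0 := by
      intro m hm
      rw [Finset.mem_Ico] at hm
      rcases Nat.even_or_odd m with hm' | hm'
      · rw [coeff_cosQ_sub_one_odd hι (Nat.Odd.sub_even hm.2.le hn hm'), mul_zero]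
      · rw [coeff_altEgfEven_of_odd s t q hm', zero_mul]
    have h2 : ∀ m ∈ Finset.Ico 2 n, coeff m (altEgfOdd s t q) *
        coeff (n - m) (rescale M (sinQ ι q)) = 0 := by
      intro m hm
      rw [Finset.mem_Ico] at hm
      rcases Nat.even_or_odd m with hm' | hm'
      · rw [coeff_altEgfOdd_of_even s t q hm', zero_mul]
      · rw [coeff_sinQ_even hι (Nat.Odd.sub_odd hn hm'), mul_zero]
    rw [Finset.sum_eq_zero h1, Finset.sum_eq_zero h2, coeff_altEgfEven_of_odd s t q hn,
      coeff_transED_odd hι hn]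
    ring

theorem altEgfOdd_system (hι : ι ^ 2 = -1) (hM : M ^ 2 = (1 - s) * (1 - t)) (hM0 : M ≠ 0)
    (hs1 : s ≠ 1) (hq : ∀ n : ℕ, qFact q n ≠ 0) (hD : ∀ n : ℕ, poly n 1 q ≠ 0) :
    C (r * (1 - t)) * altEgfOdd s t q = transOD ι M r s t q +
      C (r * t) * (altEgfOdd s t q * (rescale M (cosQ ι q) - 1)) +
      C (r * (1 - t) / M) * (altEgfEven s t q * rescale M (sinQ ι q)) := by
  have hE : ∀ m < 2, coeff m (altEgfEven s t q) = 0 := fun m hm => coeff_altEgfEven_of_lt s t q hm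
  have hO : ∀ m < 2, coeff m (altEgfOdd s t q) = 0 := fun m hm => coeff_altEgfOdd_of_lt s t q hm
  ext n
  rw [map_add, map_add, coeff_C_mul, coeff_C_mul, coeff_C_mul,
    coeff_mul_eq_sum_Ico hO (coeff_zero_cosQ_sub_one hι hM),
    coeff_mul_eq_sum_Ico hE (coeff_sinQ_even hι Even.zero)]
  rcases Nat.even_or_odd n with hn | hn
  · have h1 : ∀ m ∈ Finset.Ico 2 n, coeff m (altEgfOdd s t q) *
        coeff (n - m) (rescale M (cosQ ι q) - 1) = 0 := by
      intro m hm
      rw [Finset.mem_Ico] at hm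
      rcases Nat.even_or_odd m with hm' | hm'
      · rw [coeff_altEgfOdd_of_even s t q hm', zero_mul]
      · rw [coeff_cosQ_sub_one_odd hι (Nat.Even.sub_odd hm.2.le hn hm'), mul_zero]
    have h2 : ∀ m ∈ Finset.Ico 2 n, coeff m (altEgfEven s t q) *
        coeff (n - m) (rescale M (sinQ ι q)) = 0 := by
      intro m hm
      rcases Nat.even_or_odd m with hm' | hm'
      · rw [coeff_sinQ_even hι (hn.tsub hm'), mul_zero]
      · rw [coeff_altEgfEven_of_odd s t q hm', zero_mul]
    rw [Finset.sum_eq_zero h1, Finset.sum_eq_zero h2, coeff_altEgfOdd_of_even s t q hn,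
      coeff_transOD_even hι hn]
    ring
  · rcases lt_or_ge n 2 with hlt | hge
    · obtain rfl : n = 1 := by
        obtain ⟨b, rfl⟩ := hn
        omega
      rw [coeff_one_transOD hι hM, hO 1 hlt]
      simp
    · obtain ⟨a, rfl⟩ : ∃ a, n = 2 * (a + 1) + 1 := by
        obtain ⟨b, rfl⟩ := hn
        exact ⟨b - 1, by omega⟩
      have hW := prod_ascWeight_even s t 1 a
      rw [show 1 + (2 * a + 2) = 2 * (a + 1) + 1 by ring] at hW
      have hw1 : ascWeight s t (1 + 1) = s - 1 := by
        rw [ascWeight, if_neg (by decide)]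
      rw [coeff_transOD_odd hι hM hM0 hs1, coeff_altEgfOdd_of_odd s t q hn (by omega),
        altPoly_div_poly_eq s t q hq hD (by omega), hW, hw1, mul_add (r * (1 - t)),
        add_assoc (r * _), Nat.add_sub_cancel]
      congr 1
      · ring
      rw [Finset.mul_sum, Finset.mul_sum, Finset.mul_sum, ← Finset.sum_add_distrib]
      refine Finset.sum_congr rfl fun m hm => ?_
      rw [Finset.mem_Ico] at hm
      rcases Nat.even_or_odd m with hm' | hm'
      · obtain ⟨b, hb⟩ : ∃ b, 2 * (a + 1) + 1 = m + (2 * b + 1) := by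
          obtain ⟨c, rfl⟩ := hm'
          exact ⟨a + 1 - c, by omega⟩
        rw [hb, prod_ascWeight_odd, Nat.add_sub_cancel_left, coeff_sinQ_odd hι hM,
          coeff_altEgfEven_of_even s t q hm' hm.1, coeff_altEgfOdd_of_even s t q hm', freeWeight,
          if_neg (Nat.not_odd_iff_even.2 hm')]
        field_simp
        ring
      · obtain ⟨b, hb⟩ : ∃ b, 2 * (a + 1) + 1 = m + (2 * b + 2) := by
          obtain ⟨c, rfl⟩ := hm'
          exact ⟨a - c, by omega⟩
        have hw : ascWeight s t (m + 1) = s - 1 := by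
          rw [ascWeight, if_neg (Nat.not_odd_iff_even.2 hm'.add_one)]
        rw [hb, prod_ascWeight_even, Nat.add_sub_cancel_left, coeff_cosQ_sub_one hι hM, hw,
          coeff_altEgfOdd_of_odd s t q hm' hm.1, coeff_altEgfEven_of_odd s t q hm', freeWeight,
          if_pos hm']
        ring

theorem constantCoeff_altDenom (hι : ι ^ 2 = -1) (hM : M ^ 2 = (1 - s) * (1 - t)) :
    constantCoeff (altDenom ι M s t q) = (s - 1) * (1 - t) := by
  have h1 := coeff_cosQ_even (q := q) hι hM 0
  have h2 := coeff_sinQ_even (q := q) (M := M) hι Even.zero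
  rw [mul_zero, pow_zero] at h1
  rw [coeff_zero_eq_constantCoeff_apply] at h1 h2
  rw [altDenom, mul_assoc, rescale_expQ_mul_rescale_expQ hι]
  simp only [map_add, map_sub, map_mul, map_pow, h1, h2, constantCoeff_C]
  simp [qFact]
  ring

end System

end TypeD

theorem mainTheorem4 {K : Type*} [Field K] [CharZero K]
    (s t q M r ι : K)
    (hM : M ^ 2 = (1 - s) * (1 - t)) (hr : r ^ 2 = s) (hι : ι ^ 2 = -1)
    (hs0 : s ≠ 0) (hs1 : s ≠ 1) (ht1 : t ≠ 1)
    (hq : ∀ n : ℕ, 1 ≤ n → TypeD.qNat q n ≠ 0)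
    (hD : ∀ n : ℕ, TypeD.poly n 1 q ≠ 0) :
    PowerSeries.constantCoeff (TypeD.altDenom ι M s t q) ≠ 0 ∧
    TypeD.altEgfEven s t q =
      (TypeD.transED ι M s t q *
          (1 - PowerSeries.C t * PowerSeries.rescale M (TypeD.cosQ ι q))
        + TypeD.transOD ι M r s t q *
          (PowerSeries.C (t * (s - 1) * r / (M * s)) *
            PowerSeries.rescale M (TypeD.sinQ ι q)))
        * (TypeD.altDenom ι M s t q)⁻¹ ∧
    TypeD.altEgfOdd s t q =
      (PowerSeries.C (1 / r) * TypeD.transOD ι M r s t q *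
          (PowerSeries.C s - PowerSeries.rescale M (TypeD.cosQ ι q))
        + TypeD.transED ι M s t q *
          (PowerSeries.C ((1 - t) / M) * PowerSeries.rescale M (TypeD.sinQ ι q)))
        * (TypeD.altDenom ι M s t q)⁻¹ := by
  have hs1' : s - 1 ≠ 0 := sub_ne_zero.2 hs1
  have ht1' : 1 - t ≠ 0 := sub_ne_zero.2 ht1.symm
  have hM0 : M ≠ 0 := by
    rintro rfl
    rw [zero_pow two_ne_zero] at hM
    exact mul_ne_zero (sub_ne_zero.2 hs1.symm) ht1' hM.symm
  have hr0 : r ≠ 0 := by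
    rintro rfl
    exact hs0 (by rw [← hr, zero_pow two_ne_zero])
  have hfact : ∀ n : ℕ, TypeD.qFact q n ≠ 0 := fun n =>
    Finset.prod_ne_zero_iff.2 fun i hi => hq i (Finset.mem_Icc.1 hi).1
  have hden : PowerSeries.constantCoeff (TypeD.altDenom ι M s t q) ≠ 0 := by
    rw [TypeD.constantCoeff_altDenom hι hM]
    exact mul_ne_zero hs1' ht1'
  have h1 := TypeD.altEgfEven_system hι hM hM0 hfact hD
  have h2 := TypeD.altEgfOdd_system (r := r) hι hM hM0 hs1 hfact hD
  have hdef : TypeD.altDenom ι M s t q = C s - C (s * t + 1) * rescale M (TypeD.cosQ ι q) +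
      C t * (rescale M (TypeD.cosQ ι q) ^ 2 + rescale M (TypeD.sinQ ι q) ^ 2) := by
    rw [TypeD.altDenom, mul_assoc, TypeD.rescale_expQ_mul_rescale_expQ hι]
  have hrr : (C r * C (1 / r) : PowerSeries K) = 1 := by
    rw [← map_mul, mul_one_div_cancel hr0, map_one]
  have hMM : (C M * C (1 / M) : PowerSeries K) = 1 := by
    rw [← map_mul, mul_one_div_cancel hM0, map_one]
  have hM2 : (C M : PowerSeries K) ^ 2 = (1 - C s) * (1 - C t) := by
    rw [← map_pow, hM]
    simp
  have e1 : (C (t * (s - 1) / M) : PowerSeries K) = C t * (C s - 1) * C (1 / M) := by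
    rw [div_eq_mul_one_div, map_mul, map_mul, map_sub, map_one]
  have e2 : (C (r * (1 - t) / M) : PowerSeries K) = C r * (1 - C t) * C (1 / M) := by
    rw [div_eq_mul_one_div, map_mul, map_mul, map_sub, map_one]
  have e3 : (C (t * (s - 1) * r / (M * s)) : PowerSeries K) =
      C t * (C s - 1) * C (1 / M) * C (1 / r) := by
    rw [← e1, ← map_mul, ← hr]
    congr 1
    field_simp
  have e4 : (C ((1 - t) / M) : PowerSeries K) = (1 - C t) * C (1 / M) := by
    rw [div_eq_mul_one_div, map_mul, map_sub, map_one]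
  rw [e1] at h1
  rw [e2] at h2
  simp only [map_mul, map_sub, map_add, map_one] at h1 h2 hdef
  have him : (C (1 / M) : PowerSeries K) ^ 2 * ((1 - C s) * (1 - C t)) = 1 := by
    rw [← hM2, ← mul_pow, mul_comm, hMM, one_pow]
  set E := TypeD.altEgfEven s t q
  set O := TypeD.altEgfOdd s t q
  set c := rescale M (TypeD.cosQ ι q)
  set d := rescale M (TypeD.sinQ ι q)
  have hTE : TypeD.transED ι M s t q =
      (C s - c) * E - C t * (C s - 1) * C (1 / M) * (O * d) := by
    linear_combination -h1
  have hTO : TypeD.transOD ι M r s t q =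
      C r * ((1 - C t * c) * O - (1 - C t) * C (1 / M) * (E * d)) := by
    linear_combination -h2
  refine ⟨hden, ?_, ?_⟩
  · rw [PowerSeries.eq_mul_inv_iff_mul_eq hden, hdef, e3, hTE, hTO]
    linear_combination (-((1 - C t * c) * O - (1 - C t) * C (1 / M) * (E * d)) *
      (C t * (C s - 1) * C (1 / M) * d)) * hrr - E * C t * d ^ 2 * him
  · rw [PowerSeries.eq_mul_inv_iff_mul_eq hden, hdef, e4, hTE, hTO]
    linear_combination (-((1 - C t * c) * O - (1 - C t) * C (1 / M) * (E * d)) * (C s - c)) *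
      hrr - O * C t * d ^ 2 * him
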